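/- **Soundness and completeness of the sequent calculus of first-order $\mathrm{BD}^{\supset,\mathsf F}$.** *Language.* Fix a countably infinite set of variables and, for every $n\ge 0$, a finite or countably infinite set of $n$-ary function symbols and a finite or countably infinite set of $n$-ary predicate symbols, with $=$ among the binary predicate symbols. Terms are built as usual; formulas are built from the atomic formulas $P(t_1,\dots,t_n)$ and $\mathsf F$ with $\neg,\wedge,\vee,\supset,\forall x,\exists x$. A literal is an atomic formula ($\mathsf F$ included) or the negation of one. $[x:=t]A$ is capture-avoiding substitution. *Semantics.* The truth values are $t,f,b,n$, ordered with $f$ least, $t$ greatest and $b,n$ incomparable; $t$ and $b$ are designated. $\mathsf F$ has value $f$; $\neg$ exchanges $t$ and $f$ and fixes $b$ and $n$; $\wedge,\forall$ are infima and $\vee,\exists$ are suprema; $a_1\supset a_2$ has value $a_2$ if $a_1$ is designated and $t$ otherwise. A structure has a non-empty domain $U$, interprets $n$-ary function symbols by functions $U^n\to U$ and $n$-ary predicate symbols by functions $U^n\to\{t,f,b,n\}$, and is such that ${=}(d_1,d_2)$ is designated if and only if $d_1=d_2$. The quantifiers range over $U$. For sets of formulas $\Gamma,\Delta$, $\Gamma\models\Delta$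 means: for every structure and every assignment of elements of its domain to the variables, if all formulas in $\Gamma$ have a designated value, then some formula in $\Delta$ has a designated value. *Proof system.* A sequent $\Gamma\Rightarrow\Delta$ consists of two finite sets of formulas; commas denote unions and $A$ stands for $\{A\}$. The rules are the following (premises / conclusion). - Id: $/\ A,\Gamma\Rightarrow\Delta,A$ for a literal $A$. Cut: $\Gamma\Rightarrow\Delta,A$ and $A,\Gamma'\Rightarrow\Delta'$ $/\ \Gamma',\Gamma\Rightarrow\Delta,\Delta'$. - $\mathsf F$-L: $/\ \mathsf F,\Gamma\Rightarrow\Delta$. $\neg\mathsf F$-R: $/\ \Gamma\Rightarrow\Delta,\neg\mathsf F$. - $\wedge$-L: $A_1,A_2,\Gamma\Rightarrow\Delta\ /\ A_1\wedge A_2,\Gamma\Rightarrow\Delta$. $\wedge$-R: $\Gamma\Rightarrow\Delta,A_1$ and $\Gamma\Rightarrow\Delta,A_2$ $/\ \Gamma\Rightarrow\Delta,A_1\wedge A_2$. - $\vee$-L: $A_1,\Gamma\Rightarrow\Delta$ and $A_2,\Gamma\Rightarrow\Delta$ $/\ A_1\vee A_2,\Gamma\Rightarrow\Delta$. $\vee$-R: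 $\Gamma\Rightarrow\Delta,A_1,A_2\ /\ \Gamma\Rightarrow\Delta,A_1\vee A_2$. - $\supset$-L: $\Gamma\Rightarrow\Delta,A_1$ and $A_2,\Gamma\Rightarrow\Delta$ $/\ A_1\supset A_2,\Gamma\Rightarrow\Delta$. $\supset$-R: $A_1,\Gamma\Rightarrow\Delta,A_2\ /\ \Gamma\Rightarrow\Delta,A_1\supset A_2$. - $\forall$-L: $[x:=t]A,\Gamma\Rightarrow\Delta\ /\ \forall x A,\Gamma\Rightarrow\Delta$. $\forall$-R$^\dagger$: $\Gamma\Rightarrow\Delta,[x:=y]A\ /\ \Gamma\Rightarrow\Delta,\forall xA$. - $\exists$-L$^\dagger$: $[x:=y]A,\Gamma\Rightarrow\Delta\ /\ \exists x A,\Gamma\Rightarrow\Delta$. $\exists$-R: $\Gamma\Rightarrow\Delta,[x:=t]A\ /\ \Gamma\Rightarrow\Delta,\exists xA$. - $\neg\neg$-L: $A,\Gamma\Rightarrow\Delta\ /\ \neg\neg A,\Gamma\Rightarrow\Delta$. $\neg\neg$-R: $\Gamma\Rightarrow\Delta,A\ /\ \Gamma\Rightarrow\Delta,\neg\neg A$.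 - $\neg\wedge$-L: $\neg A_1,\Gamma\Rightarrow\Delta$ and $\neg A_2,\Gamma\Rightarrow\Delta$ $/\ \neg(A_1\wedge A_2),\Gamma\Rightarrow\Delta$. $\neg\wedge$-R: $\Gamma\Rightarrow\Delta,\neg A_1,\neg A_2\ /\ \Gamma\Rightarrow\Delta,\neg(A_1\wedge A_2)$. - $\neg\vee$-L: $\neg A_1,\neg A_2,\Gamma\Rightarrow\Delta\ /\ \neg(A_1\vee A_2),\Gamma\Rightarrow\Delta$. $\neg\vee$-R: $\Gamma\Rightarrow\Delta,\neg A_1$ and $\Gamma\Rightarrow\Delta,\neg A_2$ $/\ \Gamma\Rightarrow\Delta,\neg(A_1\vee A_2)$. - $\neg\supset$-L: $A_1,\neg A_2,\Gamma\Rightarrow\Delta\ /\ \neg(A_1\supset A_2),\Gamma\Rightarrow\Delta$. $\neg\supset$-R: $\Gamma\Rightarrow\Delta,A_1$ and $\Gamma\Rightarrow\Delta,\neg A_2$ $/\ \Gamma\Rightarrow\Delta,\neg(A_1\supset A_2)$. - $\neg\forall$-L$^\dagger$: $\neg[x:=y]A,\Gamma\Rightarrow\Delta\ /\ \neg\forall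 x A,\Gamma\Rightarrow\Delta$. $\neg\forall$-R: $\Gamma\Rightarrow\Delta,\neg[x:=t]A\ /\ \Gamma\Rightarrow\Delta,\neg\forall xA$. - $\neg\exists$-L: $\neg[x:=t]A,\Gamma\Rightarrow\Delta\ /\ \neg\exists x A,\Gamma\Rightarrow\Delta$. $\neg\exists$-R$^\dagger$: $\Gamma\Rightarrow\Delta,\neg[x:=y]A\ /\ \Gamma\Rightarrow\Delta,\neg\exists xA$. - $=$-Refl: $t=t,\Gamma\Rightarrow\Delta\ /\ \Gamma\Rightarrow\Delta$. $=$-Repl: $[x:=t_1]A,\Gamma\Rightarrow\Delta\ /\ t_1=t_2,[x:=t_2]A,\Gamma\Rightarrow\Delta$ for a literal $A$. Restriction $\dagger$: $y$ is not free in $\Gamma$ or $\Delta$, and $y$ is not free in $A$ unless $x$ and $y$ are the same variable. A sequent is provable if it is the last member of a finite sequence of sequents each of which is the conclusion of an instance of a rule whose premises occur earlier in the sequence. For sets of formulas $\Gamma,\Delta$, $\Gamma\vdash\Delta$ means that $\Gamma'\Rightarrow\Delta'$ is provable for some finite $\Gamma'\subseteq\Gamma$ and $\Delta'\subseteq\Delta$.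 **Theorem.** For all sets of formulas $\Gamma$ and $\Delta$, $\ \Gamma\vdash\Delta$ if and only if $\Gamma\models\Delta$. -/

import Mathlib

universe u w

namespace BDif

/-! ### The four-valued matrix -/

/-- The truth values: true, false, both true and false, neither true nor false. -/
inductive TV : Type
  | t | f | b | n
  deriving DecidableEq

namespace TV

instance : Fintype TV := ⟨{t, f, b, n}, fun x => by cases x <;> decide⟩

/-- The truth order: `f` is least, `t` is greatest, `b` and `n` are incomparable. -/
protected def le (x y : TV) : Prop := x = y ∨ x = f ∨ y = t

instance : LE TV := ⟨TV.le⟩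

instance : DecidableRel (fun x y : TV => x ≤ y) := fun x y =>
  inferInstanceAs (Decidable (x = y ∨ x = f ∨ y = t))

/-- Binary greatest lower bound. -/
protected def inf : TV → TV → TV
  | t, y => y
  | x, t => x
  | b, b => b
  | n, n => n
  | _, _ => f

/-- Binary least upper bound. -/
protected def sup : TV → TV → TV
  | f, y => y
  | x, f => x
  | b, b => b
  | n, n => n
  | _, _ => t

instance : Lattice TV where
  le_refl := by decide
  le_trans := by decide
  le_antisymm := by decide
  inf := TV.inf
  sup := TV.sup
  inf_le_left := by decide
  inf_le_right := by decide
  le_inf := by decide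
  le_sup_left := by decide
  le_sup_right := by decide
  sup_le := by decide

instance : BoundedOrder TV where
  top := t
  bot := f
  le_top := by decide
  bot_le := by decide

/-- `sInf` and `sSup` are the greatest lower and least upper bounds in the truth order. -/
noncomputable instance : CompleteLattice TV := Fintype.toCompleteLattice TV

/-- The designated truth values. -/
def designated : Set TV := {t, b}

/-- The truth function of negation. -/
def neg : TV → TV
  | t => f
  | f => t
  | b => b
  | n => n

open Classical in
/-- The truth function of implication. -/
noncomputable def imp (x y : TV) : TV := if x ∈ designated then y else t

end TV

/-! ### The language -/

/-- A choice of non-logical symbols: a countably infinite set of variables and, for each arity, a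
countable set of function symbols and of predicate symbols, with a distinguished binary predicate
symbol for equality. Symbols of arity `0` are the constant and the proposition symbols. -/
structure Alphabet where
  Var : Type u
  Func : ℕ → Type u
  Pred : ℕ → Type u
  eq : Pred 2
  var_infinite : Infinite Var
  var_countable : Countable Var
  func_countable : ∀ k, Countable (Func k)
  pred_countable : ∀ k, Countable (Pred k)

attribute [instance] Alphabet.var_infinite Alphabet.var_countable Alphabet.func_countable
  Alphabet.pred_countable

noncomputable instance (S : Alphabet.{u}) : DecidableEq S.Var := Classical.decEq _

/-- Terms. -/
inductive Term (S : Alphabet.{u}) : Type u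
  | var (x : S.Var) : Term S
  | func {k : ℕ} (g : S.Func k) (ts : Fin k → Term S) : Term S

/-- Formulas, with falsity, negation, conjunction, disjunction, implication and the two
quantifiers. -/
inductive Formula (S : Alphabet.{u}) : Type u
  | pred {k : ℕ} (P : S.Pred k) (ts : Fin k → Term S) : Formula S
  | fls : Formula S
  | neg (A : Formula S) : Formula S
  | conj (A B : Formula S) : Formula S
  | disj (A B : Formula S) : Formula S
  | imp (A B : Formula S) : Formula S
  | all (x : S.Var) (A : Formula S) : Formula S
  | ex (x : S.Var) (A : Formula S) : Formula S

noncomputable instance (S : Alphabet.{u}) : DecidableEq (Formula S) := Classical.decEq _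

variable {S : Alphabet.{u}}

/-- The equation `t₁ = t₂`. -/
def Formula.equal (t₁ t₂ : Term S) : Formula S := .pred S.eq ![t₁, t₂]

/-- Atomic formulas (falsity is one of them). -/
inductive Formula.IsAtomic : Formula S → Prop
  | pred {k : ℕ} (P : S.Pred k) (ts : Fin k → Term S) : IsAtomic (.pred P ts)
  | fls : IsAtomic .fls

/-- Literals: atomic formulas and negations of atomic formulas. -/
def Formula.IsLiteral (A : Formula S) : Prop :=
  A.IsAtomic ∨ ∃ B : Formula S, B.IsAtomic ∧ A = .neg B

/-! ### Free variables and substitution -/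

/-- The variables of a term. -/
noncomputable def Term.fv : Term S → Finset S.Var
  | .var x => {x}
  | .func _ ts => Finset.univ.biUnion fun i => (ts i).fv

/-- The free variables of a formula. -/
noncomputable def Formula.fv : Formula S → Finset S.Var
  | .pred _ ts => Finset.univ.biUnion fun i => (ts i).fv
  | .fls => ∅
  | .neg A => A.fv
  | .conj A B => A.fv ∪ B.fv
  | .disj A B => A.fv ∪ B.fv
  | .imp A B => A.fv ∪ B.fv
  | .all x A => A.fv.erase x
  | .ex x A => A.fv.erase x

/-- Simultaneous substitution in a term. -/
def Term.subst (σ : S.Var → Term S) : Term S → Term S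
  | .var x => σ x
  | .func g ts => .func g fun i => (ts i).subst σ

/-- The name used for the bound variable when `σ` is applied to a quantification of `A` over `x`:
it is `x` itself unless `x` occurs in a term that `σ` substitutes for a free variable of the
quantified formula; in that case it is a variable that occurs in no such term. -/
noncomputable def boundName (σ : S.Var → Term S) (x : S.Var) (A : Formula S) : S.Var :=
  let avoid : Finset S.Var := (A.fv.erase x).biUnion fun v => (σ v).fv
  if x ∈ avoid then Classical.choose (Infinite.exists_notMem_finset avoid) else x

/-- Simultaneous capture-avoiding substitution for the free variables of a formula. -/
noncomputable def Formula.subst : (S.Var → Term S) → Formula S → Formula S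
  | σ, .pred P ts => .pred P fun i => (ts i).subst σ
  | _, .fls => .fls
  | σ, .neg A => .neg (A.subst σ)
  | σ, .conj A B => .conj (A.subst σ) (B.subst σ)
  | σ, .disj A B => .disj (A.subst σ) (B.subst σ)
  | σ, .imp A B => .imp (A.subst σ) (B.subst σ)
  | σ, .all x A => .all (boundName σ x A)
      (A.subst (Function.update σ x (.var (boundName σ x A))))
  | σ, .ex x A => .ex (boundName σ x A)
      (A.subst (Function.update σ x (.var (boundName σ x A))))

/-- The result of substituting the term `t` for the free occurrences of `x` in `A`. -/
noncomputable def Formula.inst (A : Formula S) (x : S.Var) (t : Term S) : Formula S :=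
  A.subst (Function.update Term.var x t)

/-! ### Structures, truth values of formulas, logical consequence -/

/-- Structures: a non-empty domain, an interpretation of the function symbols, and a four-valued
interpretation of the predicate symbols in which an equation is designated exactly when both
sides are the same element (it may be just true, or both true and false, in that case, and just
false, or neither, otherwise). -/
structure Model (S : Alphabet.{u}) where
  Dom : Type w
  nonempty : Nonempty Dom
  func : ∀ {k : ℕ}, S.Func k → (Fin k → Dom) → Dom
  pred : ∀ {k : ℕ}, S.Pred k → (Fin k → Dom) → TV
  eq_designated : ∀ d e : Dom, pred S.eq ![d, e] ∈ TV.designated ↔ d = e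

/-- The value of a term under an assignment. -/
def Term.eval (M : Model.{u, w} S) (α : S.Var → M.Dom) : Term S → M.Dom
  | .var x => α x
  | .func g ts => M.func g fun i => (ts i).eval M α

/-- The truth value of a formula under an assignment. -/
noncomputable def Formula.eval (M : Model.{u, w} S) : (S.Var → M.Dom) → Formula S → TV
  | α, .pred P ts => M.pred P fun i => (ts i).eval M α
  | _, .fls => TV.f
  | α, .neg A => TV.neg (A.eval M α)
  | α, .conj A B => A.eval M α ⊓ B.eval M α
  | α, .disj A B => A.eval M α ⊔ B.eval M α
  | α, .imp A B => TV.imp (A.eval M α) (B.eval M α)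
  | α, .all x A => sInf (Set.range fun d : M.Dom => A.eval M (Function.update α x d))
  | α, .ex x A => sSup (Set.range fun d : M.Dom => A.eval M (Function.update α x d))

/-- `Δ` is a logical consequence of `Γ`: under every assignment in every structure in which all
formulas of `Γ` are designated, some formula of `Δ` is designated. -/
def Consequence (Γ Δ : Set (Formula S)) : Prop :=
  ∀ (M : Model.{u, w} S) (α : S.Var → M.Dom),
    (∀ A ∈ Γ, A.eval M α ∈ TV.designated) → ∃ A ∈ Δ, A.eval M α ∈ TV.designated

/-! ### The sequent calculus -/

/-- Sequents: pairs of finite sets of formulas. -/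
structure Sequent (S : Alphabet.{u}) where
  ante : Finset (Formula S)
  succ : Finset (Formula S)

infix:40 " ⇒ " => Sequent.mk

/-- The restriction on the variable `y` in the quantifier rules. -/
def Eigen (y x : S.Var) (A : Formula S) (Γ Δ : Finset (Formula S)) : Prop :=
  (∀ B ∈ Γ, y ∉ B.fv) ∧ (∀ B ∈ Δ, y ∉ B.fv) ∧ (y ∉ A.fv ∨ x = y)

open Formula in
/-- The inference rules: `Rule ps s` says that `s` is the conclusion of an instance of an inference
rule with premises `ps`. -/
inductive Rule : List (Sequent S) → Sequent S → Prop
  | id (A Γ Δ) : A.IsLiteral → Rule [] (insert A Γ ⇒ insert A Δ)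
  | cut (A Γ Δ Γ' Δ') : Rule [Γ ⇒ insert A Δ, insert A Γ' ⇒ Δ'] (Γ' ∪ Γ ⇒ Δ ∪ Δ')
  | fls_left (Γ Δ) : Rule [] (insert fls Γ ⇒ Δ)
  | conj_left (A B Γ Δ) :
      Rule [insert A (insert B Γ) ⇒ Δ] (insert (conj A B) Γ ⇒ Δ)
  | conj_right (A B Γ Δ) :
      Rule [Γ ⇒ insert A Δ, Γ ⇒ insert B Δ] (Γ ⇒ insert (conj A B) Δ)
  | disj_left (A B Γ Δ) :
      Rule [insert A Γ ⇒ Δ, insert B Γ ⇒ Δ] (insert (disj A B) Γ ⇒ Δ)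
  | disj_right (A B Γ Δ) :
      Rule [Γ ⇒ insert A (insert B Δ)] (Γ ⇒ insert (disj A B) Δ)
  | imp_left (A B Γ Δ) :
      Rule [Γ ⇒ insert A Δ, insert B Γ ⇒ Δ] (insert (imp A B) Γ ⇒ Δ)
  | imp_right (A B Γ Δ) :
      Rule [insert A Γ ⇒ insert B Δ] (Γ ⇒ insert (imp A B) Δ)
  | all_left (x A t Γ Δ) :
      Rule [insert (inst A x t) Γ ⇒ Δ] (insert (all x A) Γ ⇒ Δ)
  | all_right (x y A Γ Δ) : Eigen y x A Γ Δ →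
      Rule [Γ ⇒ insert (inst A x (.var y)) Δ] (Γ ⇒ insert (all x A) Δ)
  | ex_left (x y A Γ Δ) : Eigen y x A Γ Δ →
      Rule [insert (inst A x (.var y)) Γ ⇒ Δ] (insert (ex x A) Γ ⇒ Δ)
  | ex_right (x A t Γ Δ) :
      Rule [Γ ⇒ insert (inst A x t) Δ] (Γ ⇒ insert (ex x A) Δ)
  | neg_fls_right (Γ Δ) : Rule [] (Γ ⇒ insert (neg fls) Δ)
  | neg_neg_left (A Γ Δ) :
      Rule [insert A Γ ⇒ Δ] (insert (neg (neg A)) Γ ⇒ Δ)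
  | neg_neg_right (A Γ Δ) :
      Rule [Γ ⇒ insert A Δ] (Γ ⇒ insert (neg (neg A)) Δ)
  | neg_conj_left (A B Γ Δ) :
      Rule [insert (neg A) Γ ⇒ Δ, insert (neg B) Γ ⇒ Δ] (insert (neg (conj A B)) Γ ⇒ Δ)
  | neg_conj_right (A B Γ Δ) :
      Rule [Γ ⇒ insert (neg A) (insert (neg B) Δ)] (Γ ⇒ insert (neg (conj A B)) Δ)
  | neg_disj_left (A B Γ Δ) :
      Rule [insert (neg A) (insert (neg B) Γ) ⇒ Δ] (insert (neg (disj A B)) Γ ⇒ Δ)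
  | neg_disj_right (A B Γ Δ) :
      Rule [Γ ⇒ insert (neg A) Δ, Γ ⇒ insert (neg B) Δ] (Γ ⇒ insert (neg (disj A B)) Δ)
  | neg_imp_left (A B Γ Δ) :
      Rule [insert A (insert (neg B) Γ) ⇒ Δ] (insert (neg (imp A B)) Γ ⇒ Δ)
  | neg_imp_right (A B Γ Δ) :
      Rule [Γ ⇒ insert A Δ, Γ ⇒ insert (neg B) Δ] (Γ ⇒ insert (neg (imp A B)) Δ)
  | neg_all_left (x y A Γ Δ) : Eigen y x A Γ Δ →
      Rule [insert (neg (inst A x (.var y))) Γ ⇒ Δ] (insert (neg (all x A)) Γ ⇒ Δ)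
  | neg_all_right (x A t Γ Δ) :
      Rule [Γ ⇒ insert (neg (inst A x t)) Δ] (Γ ⇒ insert (neg (all x A)) Δ)
  | neg_ex_left (x A t Γ Δ) :
      Rule [insert (neg (inst A x t)) Γ ⇒ Δ] (insert (neg (ex x A)) Γ ⇒ Δ)
  | neg_ex_right (x y A Γ Δ) : Eigen y x A Γ Δ →
      Rule [Γ ⇒ insert (neg (inst A x (.var y))) Δ] (Γ ⇒ insert (neg (ex x A)) Δ)
  | eq_refl (t Γ Δ) : Rule [insert (equal t t) Γ ⇒ Δ] (Γ ⇒ Δ)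
  | eq_repl (x A t₁ t₂ Γ Δ) : A.IsLiteral →
      Rule [insert (inst A x t₁) Γ ⇒ Δ] (insert (equal t₁ t₂) (insert (inst A x t₂) Γ) ⇒ Δ)

/-- `l` is a derivation of the sequent `s` from the sequents in `H`: a finite sequence that ends
in `s` and whose members are in `H` or follow by an inference rule from earlier members. -/
def IsDerivation (H : Finset (Sequent S)) (s : Sequent S) (l : List (Sequent S)) : Prop :=
  l.getLast? = some s ∧
    ∀ i : Fin l.length, l.get i ∈ H ∨
      ∃ ps : List (Sequent S), Rule ps (l.get i) ∧ ∀ p ∈ ps, ∃ j : Fin l.length, j < i ∧ l.get j = p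

/-- A sequent is provable iff it has a derivation from the empty set of sequents. -/
def Provable (s : Sequent S) : Prop := ∃ l : List (Sequent S), IsDerivation ∅ s l

/-- `Δ` is derivable from `Γ`: some sequent between finite subsets of them is provable. -/
def Derivable (Γ Δ : Set (Formula S)) : Prop :=
  ∃ Γ' Δ' : Finset (Formula S), (Γ' : Set (Formula S)) ⊆ Γ ∧ (Δ' : Set (Formula S)) ⊆ Δ ∧
    Provable (Γ' ⇒ Δ')

end BDif

namespace BDif

/-! ### Designation in the four-valued matrix. -/

namespace TV

/-! Soundness is checked rule by rule (`Rule.valid`). The designated values are those above `b`, and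
the values with designated negation are those below `b`. Hence both conditions, "`A` is designated"
and "`neg A` is designated", satisfy two-valued recursive clauses, and the rules mirror these
clauses. Designation of `neg A` is not determined by designation of `A`, so every induction on
formulas treats `A` and `neg A` together.

Completeness is a Henkin argument with pairs of sets. Suppose `Γ`, `Δ` is underivable and leaves
infinitely many variables unused. Cut allows each formula to be put on one of the two sides, and
unused variables supply the witnesses that the quantifier rules ask for. There are countably many
formulas, so an ideal of underivable pairs meets all these requirements; the union `T` of its left
sides is saturated (`exists_saturated`). In the structure of terms modulo the equations in `T`, an
atom is made true according to its membership in `T` and false according to that of its negation,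
the two being independent. The formulas designated there are exactly the members of `T`
(`Saturated.exists_model`), so `Γ` holds and `Δ` fails.

If too few variables are unused, an injective renaming frees infinitely many. The proof found for
the renamed sets is not renamed back syntactically: its end sequent is valid by soundness, hence so
is the original finite sequent, and a finite sequent always leaves enough variables for the Henkin
argument (`Consequence.derivable`). -/

theorem mem_designated_iff (x : TV) : x ∈ designated ↔ b ≤ x := by
  cases x <;> simp [designated] <;> decide

theorem neg_mem_designated_iff (x : TV) : neg x ∈ designated ↔ x ≤ b := by
  cases x <;> simp [designated, neg] <;> decide

/-- The complement of the filter above `b` is the ideal below `n`, and dually the complement of the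
ideal below `b` is the filter above `n`. This is why an arbitrary supremum is designated only if
some member is, and likewise for negated infima. -/
theorem not_b_le_iff (x : TV) : ¬ b ≤ x ↔ x ≤ n := by cases x <;> decide

theorem not_le_b_iff (x : TV) : ¬ x ≤ b ↔ n ≤ x := by cases x <;> decide

theorem inf_designated (x y : TV) : x ⊓ y ∈ designated ↔ x ∈ designated ∧ y ∈ designated := by
  simp only [mem_designated_iff]; exact le_inf_iff

theorem sup_designated (x y : TV) : x ⊔ y ∈ designated ↔ x ∈ designated ∨ y ∈ designated := by
  simp only [mem_designated_iff]; revert x y; decide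

theorem neg_inf_designated (x y : TV) :
    neg (x ⊓ y) ∈ designated ↔ neg x ∈ designated ∨ neg y ∈ designated := by
  simp only [neg_mem_designated_iff]; revert x y; decide

theorem neg_sup_designated (x y : TV) :
    neg (x ⊔ y) ∈ designated ↔ neg x ∈ designated ∧ neg y ∈ designated := by
  simp only [neg_mem_designated_iff]; exact sup_le_iff

theorem imp_designated (x y : TV) :
    imp x y ∈ designated ↔ (x ∈ designated → y ∈ designated) := by
  unfold imp; split_ifs with h
  · simp [h]
  · simp only [h, false_imp_iff, iff_true]; simp [designated]

theorem neg_imp_designated (x y : TV) :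
    neg (imp x y) ∈ designated ↔ x ∈ designated ∧ neg y ∈ designated := by
  unfold imp; split_ifs with h
  · simp [h]
  · simp only [h, false_and, iff_false]; simp [neg, designated]

theorem neg_neg (x : TV) : neg (neg x) = x := by cases x <;> rfl

theorem fls_not_designated : f ∉ designated := by simp [designated]

theorem neg_fls_designated : neg f ∈ designated := by simp [designated, neg]

variable {ι : Type*} (g : ι → TV)

theorem sInf_designated : sInf (Set.range g) ∈ designated ↔ ∀ i, g i ∈ designated := by
  simp only [mem_designated_iff]
  exact le_sInf_iff.trans Set.forall_mem_range

theorem neg_sSup_designated :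
    neg (sSup (Set.range g)) ∈ designated ↔ ∀ i, neg (g i) ∈ designated := by
  simp only [neg_mem_designated_iff]
  exact sSup_le_iff.trans Set.forall_mem_range

theorem sSup_designated : sSup (Set.range g) ∈ designated ↔ ∃ i, g i ∈ designated := by
  simp only [mem_designated_iff]
  rw [← not_iff_not, not_b_le_iff]
  push Not
  simp only [not_b_le_iff]
  exact sSup_le_iff.trans Set.forall_mem_range

theorem neg_sInf_designated :
    neg (sInf (Set.range g)) ∈ designated ↔ ∃ i, neg (g i) ∈ designated := by
  simp only [neg_mem_designated_iff]
  rw [← not_iff_not, not_le_b_iff]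
  push Not
  simp only [not_le_b_iff]
  exact le_sInf_iff.trans Set.forall_mem_range

/-- The truth value that is designated iff `p` holds and has a designated negation iff `q` does. -/
noncomputable def ofProps (p q : Prop) : TV :=
  open Classical in if p then (if q then b else t) else (if q then f else n)

theorem ofProps_designated (p q : Prop) : ofProps p q ∈ designated ↔ p := by
  unfold ofProps; split_ifs <;> simp_all [designated]

theorem neg_ofProps_designated (p q : Prop) : neg (ofProps p q) ∈ designated ↔ q := by
  unfold ofProps; split_ifs <;> simp_all [designated, neg]

end TV

variable {S : Alphabet.{u}}

/-! ### Substitution -/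

theorem boundName_notMem (σ : S.Var → Term S) (x : S.Var) (A : Formula S) {v : S.Var}
    (hv : v ∈ A.fv) (hx : v ≠ x) : boundName σ x A ∉ (σ v).fv := by
  intro h
  have key : boundName σ x A ∉ (A.fv.erase x).biUnion fun v => (σ v).fv := by
    unfold boundName
    dsimp only
    split_ifs with h
    · exact Classical.choose_spec (Infinite.exists_notMem_finset
        ((A.fv.erase x).biUnion fun v => (σ v).fv))
    · exact h
  exact key (Finset.mem_biUnion.2 ⟨v, Finset.mem_erase.2 ⟨hx, hv⟩, h⟩)

theorem Term.eval_congr (M : Model.{u, w} S) {α β : S.Var → M.Dom} (t : Term S)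
    (h : ∀ v ∈ t.fv, α v = β v) : t.eval M α = t.eval M β := by
  induction t with
  | var x => exact h x (by simp [Term.fv])
  | func g ts ih =>
    simp only [Term.eval]
    congr 1; funext i
    exact ih i fun v hv => h v (by simp only [Term.fv, Finset.mem_biUnion]; exact ⟨i, by simp, hv⟩)

theorem Formula.eval_congr (M : Model.{u, w} S) {α β : S.Var → M.Dom} (A : Formula S)
    (h : ∀ v ∈ A.fv, α v = β v) : A.eval M α = A.eval M β := by
  have upd : ∀ {α β : S.Var → M.Dom} {x : S.Var} {A : Formula S},
      (∀ v ∈ A.fv.erase x, α v = β v) → ∀ d, ∀ v ∈ A.fv,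
        Function.update α x d v = Function.update β x d v := by
    intro α β x A h d v hv
    by_cases hx : v = x
    · subst hx; simp
    · simp only [Function.update_of_ne hx]; exact h v (Finset.mem_erase.2 ⟨hx, hv⟩)
  induction A generalizing α β with
  | pred P ts =>
    simp only [Formula.eval]
    congr 1; funext i
    exact Term.eval_congr M _ fun v hv =>
      h v (by simp only [Formula.fv, Finset.mem_biUnion]; exact ⟨i, by simp, hv⟩)
  | fls => rfl
  | neg A ih => simp only [Formula.eval]; rw [ih h]
  | conj A B ihA ihB | disj A B ihA ihB | imp A B ihA ihB =>
    simp only [Formula.eval]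
    rw [ihA fun v hv => h v (by simp [Formula.fv, hv]),
      ihB fun v hv => h v (by simp [Formula.fv, hv])]
  | all x A ih | ex x A ih =>
    simp only [Formula.eval]
    congr 2; funext d
    exact ih (upd h d)

theorem Term.eval_subst (M : Model.{u, w} S) (σ : S.Var → Term S) (α : S.Var → M.Dom)
    (t : Term S) : (t.subst σ).eval M α = t.eval M fun v => (σ v).eval M α := by
  induction t with
  | var x => rfl
  | func g ts ih => simp only [Term.subst, Term.eval, ih]

/-- No freeness condition is needed: `boundName` avoids every variable of the terms substituted for
the free variables of the quantified formula, so updating at the new bound variable does not change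
their values. -/
theorem Formula.eval_subst (M : Model.{u, w} S) (σ : S.Var → Term S) (α : S.Var → M.Dom)
    (A : Formula S) : (A.subst σ).eval M α = A.eval M fun v => (σ v).eval M α := by
  have upd : ∀ (σ : S.Var → Term S) (α : S.Var → M.Dom) (x : S.Var) (A : Formula S) (d : M.Dom),
      ∀ v ∈ A.fv,
        ((Function.update σ x (.var (boundName σ x A)) v).eval M
          (Function.update α (boundName σ x A) d)) =
        Function.update (fun v => (σ v).eval M α) x d v := by
    intro σ α x A d v hv
    by_cases hx : v = x
    · subst hx; simp [Term.eval]
    · simp only [Function.update_of_ne hx]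
      refine Term.eval_congr M _ fun z hz => Function.update_of_ne ?_ _ _
      rintro rfl
      exact boundName_notMem σ x A hv hx hz
  induction A generalizing σ α with
  | pred P ts => simp only [Formula.subst, Formula.eval, Term.eval_subst]
  | fls => rfl
  | neg A ih => simp only [Formula.subst, Formula.eval, ih]
  | conj A B ihA ihB | disj A B ihA ihB | imp A B ihA ihB =>
    simp only [Formula.subst, Formula.eval, ihA, ihB]
  | all x A ih | ex x A ih =>
    simp only [Formula.subst, Formula.eval]
    congr 2; funext d
    rw [ih]
    exact Formula.eval_congr M A (upd σ α x A d)

theorem Formula.eval_inst (M : Model.{u, w} S) (α : S.Var → M.Dom) (A : Formula S) (x : S.Var)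
    (t : Term S) : (A.inst x t).eval M α = A.eval M (Function.update α x (t.eval M α)) := by
  rw [Formula.inst, Formula.eval_subst]
  congr 1; funext v
  by_cases hx : v = x
  · subst hx; simp
  · simp [Function.update_of_ne hx, Term.eval]

theorem Term.fv_subst (σ : S.Var → Term S) (t : Term S) {v : S.Var}
    (hv : v ∈ (t.subst σ).fv) : ∃ z ∈ t.fv, v ∈ (σ z).fv := by
  induction t with
  | var x => exact ⟨x, by simp [Term.fv], hv⟩
  | func g ts ih =>
    simp only [Term.subst, Term.fv, Finset.mem_biUnion] at hv ⊢
    obtain ⟨i, -, hi⟩ := hv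
    obtain ⟨z, hz, h⟩ := ih i hi
    exact ⟨z, ⟨i, by simp, hz⟩, h⟩

/-- Used to see that variables outside the range of a renaming are fresh for the renamed formulas.
-/
theorem Formula.fv_subst (σ : S.Var → Term S) (A : Formula S) {v : S.Var}
    (hv : v ∈ (A.subst σ).fv) : ∃ z ∈ A.fv, v ∈ (σ z).fv := by
  induction A generalizing σ with
  | pred P ts =>
    simp only [Formula.subst, Formula.fv, Finset.mem_biUnion] at hv ⊢
    obtain ⟨i, -, hi⟩ := hv
    obtain ⟨z, hz, h⟩ := Term.fv_subst σ _ hi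
    exact ⟨z, ⟨i, by simp, hz⟩, h⟩
  | fls => simp [Formula.subst, Formula.fv] at hv
  | neg A ih => exact ih σ hv
  | conj A B ihA ihB | disj A B ihA ihB | imp A B ihA ihB =>
    simp only [Formula.subst, Formula.fv, Finset.mem_union] at hv ⊢
    rcases hv with hv | hv
    · obtain ⟨z, hz, h⟩ := ihA σ hv; exact ⟨z, .inl hz, h⟩
    · obtain ⟨z, hz, h⟩ := ihB σ hv; exact ⟨z, .inr hz, h⟩
  | all x A ih | ex x A ih =>
    simp only [Formula.subst, Formula.fv, Finset.mem_erase] at hv ⊢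
    obtain ⟨z, hz, h⟩ := ih _ hv.2
    by_cases hx : z = x
    · subst hx
      simp only [Function.update_self, Term.fv, Finset.mem_singleton] at h
      exact absurd h hv.1
    · rw [Function.update_of_ne hx] at h
      exact ⟨z, ⟨hx, hz⟩, h⟩

theorem Term.subst_of_fv (σ : S.Var → Term S) (t : Term S) (h : ∀ v ∈ t.fv, σ v = .var v) :
    t.subst σ = t := by
  induction t with
  | var x => exact h x (by simp [Term.fv])
  | func g ts ih =>
    simp only [Term.subst]
    congr 1; funext i
    exact ih i fun v hv => h v (by simp only [Term.fv, Finset.mem_biUnion]; exact ⟨i, by simp, hv⟩)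

/-- The number of connectives and quantifiers. -/
def Formula.size : Formula S → ℕ
  | .pred _ _ => 0
  | .fls => 0
  | .neg A => A.size + 1
  | .conj A B => A.size + B.size + 1
  | .disj A B => A.size + B.size + 1
  | .imp A B => A.size + B.size + 1
  | .all _ A => A.size + 1
  | .ex _ A => A.size + 1

theorem Formula.size_subst (σ : S.Var → Term S) (A : Formula S) : (A.subst σ).size = A.size := by
  induction A generalizing σ <;> simp_all [Formula.subst, Formula.size]

/-- An instance is not a subformula of the quantified formula, so inductions that pass to instances
run on size. -/
theorem Formula.size_inst (A : Formula S) (x : S.Var) (t : Term S) :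
    (A.inst x t).size = A.size := A.size_subst _

/-! ### Countability -/

/-- A numerical code of the elements of a countable type. -/
noncomputable def natCode {α : Type*} [Countable α] : α → ℕ :=
  (exists_injective_nat α).choose

theorem natCode_injective {α : Type*} [Countable α] : Function.Injective (natCode (α := α)) :=
  (exists_injective_nat α).choose_spec

/-- A numerical code of terms. -/
noncomputable def Term.code : Term S → ℕ
  | .var x => Nat.pair 0 (natCode x)
  | .func (k := k) g ts => Nat.pair 1
      (natCode (⟨⟨k, g⟩, fun i => (ts i).code⟩ : Σ p : Σ k, S.Func k, Fin p.1 → ℕ))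

theorem Term.code_injective : Function.Injective (Term.code (S := S)) := by
  intro s
  induction s with
  | var x =>
    intro t h
    cases t with
    | var y => simp only [Term.code, Nat.pair_eq_pair] at h; rw [natCode_injective h.2]
    | func g ts => simp [Term.code, Nat.pair_eq_pair] at h
  | func g ts ih =>
    intro t h
    cases t with
    | var y => simp [Term.code, Nat.pair_eq_pair] at h
    | func g' ts' =>
      simp only [Term.code, Nat.pair_eq_pair, true_and] at h
      have h := natCode_injective h
      simp only [Sigma.mk.injEq] at h
      obtain ⟨⟨rfl, h1⟩, h2⟩ := h
      obtain rfl := eq_of_heq h1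
      congr 1; funext i
      exact ih i (congrFun (eq_of_heq h2) i)

/-- Besides giving countably many formulas, this makes the domain of the term model small in every
universe. -/
instance : Countable (Term S) := Term.code_injective.countable

/-- A numerical code of formulas. -/
noncomputable def Formula.code : Formula S → ℕ
  | .pred (k := k) P ts => Nat.pair 0
      (natCode (⟨k, P, ts⟩ : Σ k, S.Pred k × (Fin k → Term S)))
  | .fls => Nat.pair 1 0
  | .neg A => Nat.pair 2 A.code
  | .conj A B => Nat.pair 3 (Nat.pair A.code B.code)
  | .disj A B => Nat.pair 4 (Nat.pair A.code B.code)
  | .imp A B => Nat.pair 5 (Nat.pair A.code B.code)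
  | .all x A => Nat.pair 6 (Nat.pair (natCode x) A.code)
  | .ex x A => Nat.pair 7 (Nat.pair (natCode x) A.code)

theorem Formula.code_injective : Function.Injective (Formula.code (S := S)) := by
  intro A
  induction A with
  | pred P ts =>
    intro B h
    cases B <;> simp [Formula.code, Nat.pair_eq_pair] at h
    have h := natCode_injective h
    simp only [Sigma.mk.injEq] at h
    obtain ⟨rfl, h⟩ := h
    simp_all
  | fls =>
    intro B h
    cases B <;> simp [Formula.code, Nat.pair_eq_pair] at h
    rfl
  | neg A ih =>
    intro B h
    cases B <;> simp [Formula.code, Nat.pair_eq_pair] at h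
    rw [ih h]
  | conj A B ihA ihB | disj A B ihA ihB | imp A B ihA ihB =>
    intro C h
    cases C <;> simp [Formula.code, Nat.pair_eq_pair] at h
    rw [ihA h.1, ihB h.2]
  | all x A ih | ex x A ih =>
    intro B h
    cases B <;> simp [Formula.code, Nat.pair_eq_pair] at h
    rw [ih h.2, natCode_injective h.1]

instance : Countable (Formula S) := Formula.code_injective.countable

open Formula

/-! ### Satisfaction -/

/-- The formula `A` has a designated value. -/
def Sat (M : Model.{u, w} S) (α : S.Var → M.Dom) (A : Formula S) : Prop :=
  A.eval M α ∈ TV.designated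

section Sat

variable (M : Model.{u, w} S) (α : S.Var → M.Dom) (A B : Formula S) (x : S.Var)

theorem sat_fls : ¬ Sat M α fls := TV.fls_not_designated
theorem sat_neg_fls : Sat M α (neg fls) := TV.neg_fls_designated
theorem sat_conj : Sat M α (conj A B) ↔ Sat M α A ∧ Sat M α B := TV.inf_designated _ _
theorem sat_disj : Sat M α (disj A B) ↔ Sat M α A ∨ Sat M α B := TV.sup_designated _ _
theorem sat_imp : Sat M α (imp A B) ↔ (Sat M α A → Sat M α B) := TV.imp_designated _ _
theorem sat_all : Sat M α (all x A) ↔ ∀ d, Sat M (Function.update α x d) A :=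
  TV.sInf_designated _
theorem sat_ex : Sat M α (ex x A) ↔ ∃ d, Sat M (Function.update α x d) A :=
  TV.sSup_designated _
theorem sat_neg_neg : Sat M α (neg (neg A)) ↔ Sat M α A := by
  unfold Sat; simp only [Formula.eval, TV.neg_neg]
theorem sat_neg_conj : Sat M α (neg (conj A B)) ↔ Sat M α (neg A) ∨ Sat M α (neg B) :=
  TV.neg_inf_designated _ _
theorem sat_neg_disj : Sat M α (neg (disj A B)) ↔ Sat M α (neg A) ∧ Sat M α (neg B) :=
  TV.neg_sup_designated _ _
theorem sat_neg_imp : Sat M α (neg (imp A B)) ↔ Sat M α A ∧ Sat M α (neg B) :=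
  TV.neg_imp_designated _ _
theorem sat_neg_all : Sat M α (neg (all x A)) ↔ ∃ d, Sat M (Function.update α x d) (neg A) :=
  TV.neg_sInf_designated _
theorem sat_neg_ex : Sat M α (neg (ex x A)) ↔ ∀ d, Sat M (Function.update α x d) (neg A) :=
  TV.neg_sSup_designated _
theorem sat_inst (t : Term S) :
    Sat M α (inst A x t) ↔ Sat M (Function.update α x (t.eval M α)) A := by
  unfold Sat; rw [eval_inst]
theorem sat_neg_inst (t : Term S) :
    Sat M α (neg (inst A x t)) ↔ Sat M (Function.update α x (t.eval M α)) (neg A) :=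
  sat_inst M α (neg A) x t
theorem sat_equal (s t : Term S) : Sat M α (equal s t) ↔ s.eval M α = t.eval M α := by
  rw [← M.eq_designated]
  unfold Sat equal
  simp only [Formula.eval]
  have : (fun i => (![s, t] i).eval M α) = ![s.eval M α, t.eval M α] := by
    funext i; fin_cases i <;> rfl
  rw [this]

variable {M α A x}

theorem sat_congr {β : S.Var → M.Dom} (h : ∀ v ∈ A.fv, α v = β v) : Sat M α A ↔ Sat M β A := by
  unfold Sat; rw [A.eval_congr M h]

theorem sat_update_of_notMem {y : S.Var} (h : y ∉ A.fv) (d : M.Dom) :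
    Sat M (Function.update α y d) A ↔ Sat M α A :=
  sat_congr fun v hv => Function.update_of_ne (by rintro rfl; exact h hv) _ _

theorem sat_eigen {y : S.Var} (h : y ∉ A.fv ∨ x = y) (d : M.Dom) :
    Sat M (Function.update (Function.update α y d) x d) A ↔ Sat M (Function.update α x d) A := by
  refine sat_congr fun v hv => ?_
  by_cases hx : v = x
  · subst hx; simp
  · simp only [Function.update_of_ne hx]
    refine Function.update_of_ne ?_ _ _
    rintro rfl
    exact h.elim (fun h => h hv) fun h => hx h.symm

end Sat

/-- Under every assignment that designates the antecedent, some formula of the succedent is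
designated. -/
def Sequent.Valid (s : Sequent S) : Prop :=
  ∀ (M : Model.{u, w} S) (α : S.Var → M.Dom),
    (∀ A ∈ s.ante, Sat M α A) → ∃ A ∈ s.succ, Sat M α A

theorem Eigen.sat_iff {y x : S.Var} {A : Formula S} {Γ Δ : Finset (Formula S)}
    (h : Eigen y x A Γ Δ) (M : Model.{u, w} S) (α : S.Var → M.Dom) (d : M.Dom) :
    ((∀ B ∈ Γ, Sat M (Function.update α y d) B) ↔ ∀ B ∈ Γ, Sat M α B) ∧
    ((∃ B ∈ Δ, Sat M (Function.update α y d) B) ↔ ∃ B ∈ Δ, Sat M α B) ∧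
    (Sat M (Function.update α y d) (inst A x (.var y)) ↔ Sat M (Function.update α x d) A) ∧
    (Sat M (Function.update α y d) (neg (inst A x (.var y))) ↔
      Sat M (Function.update α x d) (neg A)) := by
  refine ⟨forall₂_congr fun B hB => sat_update_of_notMem (h.1 B hB) d,
    exists_congr fun B => and_congr_right fun hB => sat_update_of_notMem (h.2.1 B hB) d, ?_, ?_⟩
  · rw [sat_inst]; simpa [Term.eval] using sat_eigen h.2.2 d
  · rw [sat_neg_inst]; simpa [Term.eval] using sat_eigen (A := neg A) h.2.2 d

theorem Rule.valid {ps : List (Sequent S)} {s : Sequent S} (h : Rule ps s)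
    (hp : ∀ p ∈ ps, Sequent.Valid.{u, w} p) : Sequent.Valid.{u, w} s := by
  intro M α
  -- The assignment stays open: the eigenvariable rules need their premise at a modified assignment.
  have hp := fun p hps => hp p hps M
  induction h with
  | all_right x y A Γ Δ hE | neg_ex_right x y A Γ Δ hE =>
    simp only [List.mem_cons, List.not_mem_nil, or_false, forall_eq,
      Finset.exists_mem_insert, sat_all, sat_neg_ex] at hp ⊢
    intro hΓ
    -- The split precedes the choice of `d`: if `Δ` fails at `α`, it also fails after `y` is set to
    -- any `d`, so the premise must yield the instance for each `d`.
    by_cases hΔ : ∃ B ∈ Δ, Sat M α B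
    · exact .inr hΔ
    · refine .inl fun d => ?_
      obtain ⟨h1, h2, h3, h4⟩ := hE.sat_iff M α d
      rcases hp _ (h1.2 hΓ) with h | h
      · first | exact h3.1 h | exact h4.1 h
      · exact absurd (h2.1 h) hΔ
  | ex_left x y A Γ Δ hE | neg_all_left x y A Γ Δ hE =>
    simp only [List.mem_cons, List.not_mem_nil, or_false, forall_eq,
      Finset.forall_mem_insert, sat_ex, sat_neg_all] at hp ⊢
    rintro ⟨⟨d, hd⟩, hΓ⟩
    obtain ⟨h1, h2, h3, h4⟩ := hE.sat_iff M α d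
    exact h2.1 (hp _ ⟨by first | exact h3.2 hd | exact h4.2 hd, h1.2 hΓ⟩)
  | cut A Γ Δ Γ' Δ' =>
    have hp := fun p hps => hp p hps α
    simp only [List.mem_cons, List.not_mem_nil, or_false, forall_eq_or_imp, forall_eq,
      Finset.forall_mem_insert, Finset.exists_mem_insert] at hp
    simp only [Finset.mem_union]
    intro h
    rcases hp.1 fun B hB => h B (.inr hB) with h' | ⟨B, hB, hB'⟩
    · obtain ⟨B, hB, hB'⟩ := hp.2 ⟨h', fun B hB => h B (.inl hB)⟩
      exact ⟨B, .inr hB, hB'⟩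
    · exact ⟨B, .inl hB, hB'⟩
  | all_left x A t Γ Δ | ex_right x A t Γ Δ | neg_all_right x A t Γ Δ | neg_ex_left x A t Γ Δ =>
    have hp := fun p hps => hp p hps α
    simp only [List.mem_cons, List.not_mem_nil, or_false, forall_eq, Finset.forall_mem_insert,
      Finset.exists_mem_insert, sat_all, sat_ex, sat_neg_all, sat_neg_ex, sat_inst,
      sat_neg_inst] at hp ⊢
    first
    | exact fun h => hp ⟨h.1 _, h.2⟩
    | exact fun h => (hp h).imp_left fun h => ⟨_, h⟩
  | eq_repl x A t₁ t₂ Γ Δ hA =>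
    have hp := fun p hps => hp p hps α
    simp only [List.mem_cons, List.not_mem_nil, or_false, forall_eq, Finset.forall_mem_insert,
      sat_equal, sat_inst] at hp ⊢
    rintro ⟨h1, h2, h3⟩
    exact hp ⟨h1 ▸ h2, h3⟩
  | _ =>
    have hp := fun p hps => hp p hps α
    simp only [List.mem_cons, List.not_mem_nil, or_false, forall_eq_or_imp, forall_eq,
      Finset.forall_mem_insert, Finset.exists_mem_insert, sat_fls, sat_neg_fls, sat_conj, sat_disj,
      sat_imp, sat_neg_neg, sat_neg_conj, sat_neg_disj, sat_neg_imp, sat_equal] at hp ⊢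
    tauto

/-! ### Provability -/

theorem Provable.valid {s : Sequent S} (h : Provable s) : Sequent.Valid.{u, w} s := by
  obtain ⟨l, hl, hd⟩ := h
  have key : ∀ i : Fin l.length, Sequent.Valid.{u, w} (l.get i) := by
    intro i
    induction i using WellFoundedLT.induction with
    | ind i ih =>
      rcases hd i with h | ⟨ps, hr, hps⟩
      · simp at h
      · refine hr.valid fun p hp => ?_
        obtain ⟨j, hj, rfl⟩ := hps p hp
        exact ih j hj
  obtain ⟨i, hi⟩ := List.mem_iff_get.1 (List.mem_of_getLast? hl)
  exact hi ▸ key i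

/-- Every member of the list is inferred from earlier members. -/
def IsProofList (l : List (Sequent S)) : Prop :=
  ∀ (i : ℕ) (s : Sequent S), l[i]? = some s →
    ∃ ps : List (Sequent S), Rule ps s ∧ ∀ p ∈ ps, ∃ j < i, l[j]? = some p

/-- Positions as natural numbers with optional lookup make concatenation of derivations a matter of
shifting indices. -/
theorem provable_iff_isProofList {s : Sequent S} :
    Provable s ↔ ∃ l, l.getLast? = some s ∧ IsProofList l := by
  refine exists_congr fun l => and_congr_right fun _ => ?_
  constructor
  · intro h i s hs
    obtain ⟨hi, rfl⟩ := List.getElem?_eq_some_iff.1 hs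
    rcases h ⟨i, hi⟩ with h | ⟨ps, hr, hps⟩
    · simp at h
    · refine ⟨ps, hr, fun p hp => ?_⟩
      obtain ⟨j, hj, rfl⟩ := hps p hp
      exact ⟨j, hj, List.getElem?_eq_getElem j.2⟩
  · intro h i
    obtain ⟨ps, hr, hps⟩ := h i (l.get i) (List.getElem?_eq_getElem i.2)
    refine .inr ⟨ps, hr, fun p hp => ?_⟩
    obtain ⟨j, hj, hp⟩ := hps p hp
    exact ⟨⟨j, hj.trans i.2⟩, hj, (List.getElem?_eq_some_iff.1 hp).2⟩

theorem IsProofList.append {l₁ l₂ : List (Sequent S)} (h₁ : IsProofList l₁)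
    (h₂ : IsProofList l₂) : IsProofList (l₁ ++ l₂) := by
  intro i s hs
  rw [List.getElem?_append] at hs
  split_ifs at hs with hi
  · obtain ⟨ps, hr, hps⟩ := h₁ i s hs
    refine ⟨ps, hr, fun p hp => ?_⟩
    obtain ⟨j, hj, hjp⟩ := hps p hp
    exact ⟨j, hj, by rw [List.getElem?_append_left (hj.trans hi)]; exact hjp⟩
  · obtain ⟨ps, hr, hps⟩ := h₂ _ s hs
    refine ⟨ps, hr, fun p hp => ?_⟩
    obtain ⟨j, hj, hjp⟩ := hps p hp
    refine ⟨l₁.length + j, by omega, ?_⟩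
    rw [List.getElem?_append_right (by omega), Nat.add_sub_cancel_left, hjp]

/-- Concatenate derivations of the premises and append the conclusion. From here on provability is
used only as a property closed under the rules. -/
theorem Provable.of_rule {ps : List (Sequent S)} {s : Sequent S} (h : Rule ps s)
    (hp : ∀ p ∈ ps, Provable p) : Provable s := by
  have key : ∃ l : List (Sequent S), IsProofList l ∧ ∀ p ∈ ps, p ∈ l := by
    clear h
    induction ps with
    | nil => exact ⟨[], by intro i s h; simp at h, by simp⟩
    | cons q ps ih =>
      obtain ⟨l, hl, hm⟩ := ih fun p h => hp p (by simp [h])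
      obtain ⟨l', hl', hm'⟩ := provable_iff_isProofList.1 (hp q (by simp))
      refine ⟨l' ++ l, hm'.append hl, fun p h => ?_⟩
      rcases List.mem_cons.1 h with rfl | h
      · exact List.mem_append_left _ (List.mem_of_getLast? hl')
      · exact List.mem_append_right _ (hm p h)
  obtain ⟨l, hl, hm⟩ := key
  refine provable_iff_isProofList.2 ⟨l ++ [s], by simp, fun i q hq => ?_⟩
  rw [List.getElem?_append] at hq
  split_ifs at hq with hi
  · obtain ⟨qs, hr, hqs⟩ := hl i q hq
    refine ⟨qs, hr, fun p hp => ?_⟩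
    obtain ⟨j, hj, hjp⟩ := hqs p hp
    exact ⟨j, hj, by rw [List.getElem?_append_left (hj.trans hi)]; exact hjp⟩
  · obtain ⟨hlt, rfl⟩ := List.getElem?_eq_some_iff.1 hq
    refine ⟨ps, by simpa using h, fun p hp => ?_⟩
    obtain ⟨j, hj, rfl⟩ := List.getElem_of_mem (hm p hp)
    exact ⟨j, by omega, by rw [List.getElem?_append_left hj, List.getElem?_eq_getElem hj]⟩

theorem Rule.provable₀ {s : Sequent S} (h : Rule [] s) : Provable s := .of_rule h (by simp)

theorem Rule.provable₁ {p s : Sequent S} (h : Rule [p] s) (hp : Provable p) : Provable s :=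
  .of_rule h (by simpa using hp)

theorem Rule.provable₂ {p q s : Sequent S} (h : Rule [p, q] s) (hp : Provable p)
    (hq : Provable q) : Provable s :=
  .of_rule h (by simpa using ⟨hp, hq⟩)

theorem exists_eigen (x : S.Var) (A : Formula S) (Γ Δ : Finset (Formula S)) :
    ∃ y, Eigen y x A Γ Δ := by
  obtain ⟨y, hy⟩ := Infinite.exists_notMem_finset (Γ.biUnion fv ∪ Δ.biUnion fv ∪ A.fv)
  simp only [Finset.mem_union, Finset.mem_biUnion, not_or, not_exists, not_and] at hy
  exact ⟨y, hy.1.1, hy.1.2, .inl hy.2⟩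

/-- Identity sequents for arbitrary formulas. -/
theorem provable_identity (A : Formula S) (Γ Δ : Finset (Formula S)) :
    Provable (insert A Γ ⇒ insert A Δ) := by
  -- The rules for negated compounds lead to negated components, so the claim for `neg A` is carried
  -- along.
  suffices H : ∀ (k : ℕ) (A : Formula S), A.size = k → ∀ Γ Δ,
      Provable (insert A Γ ⇒ insert A Δ) ∧ Provable (insert (neg A) Γ ⇒ insert (neg A) Δ) from
    (H _ A rfl Γ Δ).1
  clear A Γ Δ
  intro k
  induction k using Nat.strong_induction_on with
  | _ k ih =>
  intro A hA Γ Δ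
  replace ih : ∀ B : Formula S, B.size < A.size → ∀ Γ Δ,
      Provable (insert B Γ ⇒ insert B Δ) ∧ Provable (insert (neg B) Γ ⇒ insert (neg B) Δ) :=
    fun B hB => ih _ (hA ▸ hB) B rfl
  clear hA k
  cases A with
  | pred P ts =>
    exact ⟨(Rule.id _ _ _ (.inl (.pred P ts))).provable₀,
      (Rule.id _ _ _ (.inr ⟨_, .pred P ts, rfl⟩)).provable₀⟩
  | fls =>
    exact ⟨(Rule.id _ _ _ (.inl .fls)).provable₀, (Rule.id _ _ _ (.inr ⟨_, .fls, rfl⟩)).provable₀⟩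
  | neg A =>
    have h := ih A (by simp [size])
    exact ⟨(h Γ Δ).2, (Rule.neg_neg_left _ _ _).provable₁
      ((Rule.neg_neg_right _ _ _).provable₁ (h Γ Δ).1)⟩
  | conj A B =>
    have hA := ih A (by simp [size])
    have hB := ih B (by simp [size])
    exact ⟨(Rule.conj_left _ _ _ _).provable₁ ((Rule.conj_right _ _ _ _).provable₂
        (hA _ _).1 (by rw [Finset.insert_comm]; exact (hB _ _).1)),
      (Rule.neg_conj_right _ _ _ _).provable₁ ((Rule.neg_conj_left _ _ _ _).provable₂
        (hA _ _).2 (by rw [Finset.insert_comm (neg A)]; exact (hB _ _).2))⟩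
  | disj A B =>
    have hA := ih A (by simp [size])
    have hB := ih B (by simp [size])
    exact ⟨(Rule.disj_right _ _ _ _).provable₁ ((Rule.disj_left _ _ _ _).provable₂
        (hA _ _).1 (by rw [Finset.insert_comm A]; exact (hB _ _).1)),
      (Rule.neg_disj_left _ _ _ _).provable₁ ((Rule.neg_disj_right _ _ _ _).provable₂
        (hA _ _).2 (by rw [Finset.insert_comm]; exact (hB _ _).2))⟩
  | imp A B =>
    have hA := ih A (by simp [size])
    have hB := ih B (by simp [size])
    exact ⟨(Rule.imp_right _ _ _ _).provable₁ (by
        rw [Finset.insert_comm]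
        refine (Rule.imp_left _ _ _ _).provable₂ (hA _ _).1 (hB _ _).1),
      (Rule.neg_imp_left _ _ _ _).provable₁ ((Rule.neg_imp_right _ _ _ _).provable₂
        (hA _ _).1 (by rw [Finset.insert_comm]; exact (hB _ _).2))⟩
  | all x A =>
    have h := fun t => ih (inst A x t) (by simp [size, size_inst])
    -- The quantified formula itself occurs on the other side when the eigenvariable rule is
    -- applied, so it counts as context for the freshness of the variable.
    obtain ⟨y, hy⟩ := exists_eigen x A (insert (all x A) Γ) Δ
    obtain ⟨z, hz⟩ := exists_eigen x A Γ (insert (neg (all x A)) Δ)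
    exact ⟨(Rule.all_right x y A _ _ hy).provable₁
        ((Rule.all_left x A (.var y) _ _).provable₁ (h _ _ _).1),
      (Rule.neg_all_left x z A _ _ hz).provable₁
        ((Rule.neg_all_right x A (.var z) _ _).provable₁ (h _ _ _).2)⟩
  | ex x A =>
    have h := fun t => ih (inst A x t) (by simp [size, size_inst])
    obtain ⟨y, hy⟩ := exists_eigen x A (insert (neg (ex x A)) Γ) Δ
    obtain ⟨z, hz⟩ := exists_eigen x A Γ (insert (ex x A) Δ)
    exact ⟨(Rule.ex_left x z A _ _ hz).provable₁
        ((Rule.ex_right x A (.var z) _ _).provable₁ (h _ _ _).1),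
      (Rule.neg_ex_right x y A _ _ hy).provable₁
        ((Rule.neg_ex_left x A (.var y) _ _).provable₁ (h _ _ _).2)⟩

theorem provable_of_mem {A : Formula S} {Γ Δ : Finset (Formula S)} (h₁ : A ∈ Γ) (h₂ : A ∈ Δ) :
    Provable (Γ ⇒ Δ) := by
  simpa [Finset.insert_eq_of_mem h₁, Finset.insert_eq_of_mem h₂] using provable_identity A Γ Δ

/-- By soundness in a one-element structure. This settles the one sequent that Cut cannot weaken. -/
theorem not_provable_empty : ¬ Provable ((∅ : Finset (Formula S)) ⇒ ∅) := by
  intro h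
  obtain ⟨A, hA, -⟩ := Provable.valid.{u, 0} h
    { Dom := PUnit
      nonempty := ⟨⟨⟩⟩
      func := fun _ _ => ⟨⟩
      pred := fun _ _ => TV.t
      eq_designated := fun d e => by simp [TV.designated] } (fun _ => ⟨⟩) (by simp)
  simp at hA

/-- Weakening is not a rule, but Cut merges contexts: cutting a non-empty sequent on one of its own
formulas against an identity sequent with the larger context adds that context. -/
theorem Provable.weaken {Γ Δ Γ' Δ' : Finset (Formula S)} (h : Provable (Γ ⇒ Δ)) (hΓ : Γ ⊆ Γ')
    (hΔ : Δ ⊆ Δ') : Provable (Γ' ⇒ Δ') := by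
  by_cases h₁ : ∃ A, A ∈ Γ
  · obtain ⟨A, hA⟩ := h₁
    have := (Rule.cut A Γ' Δ' Γ Δ).provable₂ (provable_of_mem (hΓ hA) (by simp))
      (by rwa [Finset.insert_eq_of_mem hA])
    rwa [Finset.union_eq_right.2 hΓ, Finset.union_eq_left.2 hΔ] at this
  by_cases h₂ : ∃ A, A ∈ Δ
  · obtain ⟨A, hA⟩ := h₂
    have := (Rule.cut A Γ Δ Γ' Δ').provable₂ (by rwa [Finset.insert_eq_of_mem hA])
      (provable_of_mem (by simp) (hΔ hA))
    rwa [Finset.union_eq_left.2 hΓ, Finset.union_eq_right.2 hΔ] at this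
  · rw [Finset.eq_empty_of_forall_notMem (not_exists.1 h₁),
      Finset.eq_empty_of_forall_notMem (not_exists.1 h₂)] at h
    exact absurd h not_provable_empty

theorem Provable.cut {A : Formula S} {Γ Δ : Finset (Formula S)}
    (h₁ : Provable (Γ ⇒ insert A Δ)) (h₂ : Provable (insert A Γ ⇒ Δ)) : Provable (Γ ⇒ Δ) := by
  simpa using (Rule.cut A Γ Δ Γ Δ).provable₂ h₁ h₂

/-! ### Saturated extensions of consistent pairs -/

theorem Derivable.of_mem {A : Formula S} {Γ Δ : Set (Formula S)} (h₁ : A ∈ Γ) (h₂ : A ∈ Δ) :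
    Derivable Γ Δ :=
  ⟨{A}, {A}, by simpa, by simpa, provable_of_mem (Finset.mem_singleton_self A) (by simp)⟩

/-- By weakening, `A` may be taken to occur in the sequent whether or not it was used, and it is
separated from the rest. -/
theorem Derivable.exists_of_insert_left {A : Formula S} {Γ Δ : Set (Formula S)}
    (h : Derivable (insert A Γ) Δ) :
    ∃ F G : Finset (Formula S), (F : Set (Formula S)) ⊆ Γ ∧ (G : Set (Formula S)) ⊆ Δ ∧
      Provable (insert A F ⇒ G) := by
  obtain ⟨F, G, hF, hG, h⟩ := h
  refine ⟨F.erase A, G, fun B hB => ?_, hG,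
    h.weaken (by simp [Finset.subset_insert_iff]) subset_rfl⟩
  simp only [Finset.coe_erase, Set.mem_sdiff, Set.mem_singleton_iff] at hB
  exact (hF hB.1).resolve_left hB.2

theorem Derivable.exists_of_insert_right {A : Formula S} {Γ Δ : Set (Formula S)}
    (h : Derivable Γ (insert A Δ)) :
    ∃ F G : Finset (Formula S), (F : Set (Formula S)) ⊆ Γ ∧ (G : Set (Formula S)) ⊆ Δ ∧
      Provable (F ⇒ insert A G) := by
  obtain ⟨F, G, hF, hG, h⟩ := h
  refine ⟨F, G.erase A, hF, fun B hB => ?_,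
    h.weaken subset_rfl (by simp [Finset.subset_insert_iff])⟩
  simp only [Finset.coe_erase, Set.mem_sdiff, Set.mem_singleton_iff] at hB
  exact (hG hB.1).resolve_left hB.2

theorem Derivable.cut {A : Formula S} {Γ Δ : Set (Formula S)} (h₁ : Derivable Γ (insert A Δ))
    (h₂ : Derivable (insert A Γ) Δ) : Derivable Γ Δ := by
  obtain ⟨F₁, G₁, hF₁, hG₁, h₁⟩ := h₁.exists_of_insert_right
  obtain ⟨F₂, G₂, hF₂, hG₂, h₂⟩ := h₂.exists_of_insert_left
  refine ⟨F₁ ∪ F₂, G₁ ∪ G₂, by simp [hF₁, hF₂], by simp [hG₁, hG₂], Provable.cut (A := A)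
    (h₁.weaken Finset.subset_union_left (Finset.insert_subset_insert _ Finset.subset_union_left))
    (h₂.weaken (Finset.insert_subset_insert _ Finset.subset_union_right)
      Finset.subset_union_right)⟩

/-- The variables that are free in no formula of the two sets. -/
def freshVars (Γ Δ : Set (Formula S)) : Set S.Var :=
  {y | (∀ A ∈ Γ, y ∉ A.fv) ∧ ∀ A ∈ Δ, y ∉ A.fv}

theorem freshVars_insert_left (A : Formula S) {Γ Δ : Set (Formula S)}
    (h : (freshVars Γ Δ).Infinite) : (freshVars (insert A Γ) Δ).Infinite := by
  refine (h.sdiff A.fv.finite_toSet).mono fun y hy => ⟨?_, hy.1.2⟩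
  rintro B (rfl | hB)
  · exact hy.2
  · exact hy.1.1 B hB

theorem freshVars_insert_right (A : Formula S) {Γ Δ : Set (Formula S)}
    (h : (freshVars Γ Δ).Infinite) : (freshVars Γ (insert A Δ)).Infinite := by
  refine (h.sdiff A.fv.finite_toSet).mono fun y hy => ⟨hy.1.1, ?_⟩
  rintro B (rfl | hB)
  · exact hy.2
  · exact hy.1.2 B hB

theorem exists_freshVar (A : Formula S) {Γ Δ : Set (Formula S)}
    (h : (freshVars Γ Δ).Infinite) : ∃ y ∈ freshVars Γ Δ, y ∉ A.fv :=
  (h.sdiff A.fv.finite_toSet).nonempty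

/-- Underivable pairs that leave infinitely many variables unused. -/
abbrev ConsistentPair (S : Alphabet.{u}) : Type u :=
  {p : Set (Formula S) × Set (Formula S) // ¬ Derivable p.1 p.2 ∧ (freshVars p.1 p.2).Infinite}

/-- `Γ` has witnesses for the truth of an existential formula `A`. -/
def LeftWitnessed (A : Formula S) (Γ : Set (Formula S)) : Prop :=
  (∀ x B, A = ex x B → ∃ y, inst B x (.var y) ∈ Γ) ∧
  (∀ x B, A = neg (all x B) → ∃ y, neg (inst B x (.var y)) ∈ Γ)

/-- `Δ` has witnesses for the failure of a universal formula `A`. -/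
def RightWitnessed (A : Formula S) (Δ : Set (Formula S)) : Prop :=
  (∀ x B, A = all x B → ∃ y, inst B x (.var y) ∈ Δ) ∧
  (∀ x B, A = neg (ex x B) → ∃ y, neg (inst B x (.var y)) ∈ Δ)

namespace ConsistentPair

theorem disjoint (p : ConsistentPair S) {A : Formula S} (h₁ : A ∈ p.1.1) (h₂ : A ∈ p.1.2) :
    False :=
  p.2.1 (.of_mem h₁ h₂)

/-- If `A` can be added on neither side, Cut derives the original pair. -/
theorem exists_decided (p : ConsistentPair S) (A : Formula S) :
    ∃ q ≥ p, A ∈ q.1.1 ∨ A ∈ q.1.2 := by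
  by_cases h : Derivable (insert A p.1.1) p.1.2
  · exact ⟨⟨(p.1.1, insert A p.1.2), fun h' => p.2.1 (h'.cut h), freshVars_insert_right A p.2.2⟩,
      ⟨subset_rfl, Set.subset_insert _ _⟩, .inr (Set.mem_insert _ _)⟩
  · exact ⟨⟨(insert A p.1.1, p.1.2), h, freshVars_insert_left A p.2.2⟩,
      ⟨Set.subset_insert _ _, subset_rfl⟩, .inl (Set.mem_insert _ _)⟩

/-- Take `y` from the reserve of unused variables. A derivation using `W y` then satisfies the
eigenvariable condition, and the rule turns it into one using `A`, which is already present. The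
family `W` covers both `ex` and negated `all`. -/
theorem exists_left_witness (p : ConsistentPair S) {A B : Formula S} {x : S.Var}
    (hA : A ∈ p.1.1) (W : S.Var → Formula S)
    (hW : ∀ y Γ Δ, Eigen y x B Γ Δ → Rule [insert (W y) Γ ⇒ Δ] (insert A Γ ⇒ Δ)) :
    ∃ q ≥ p, ∃ y, W y ∈ q.1.1 := by
  obtain ⟨y, hy, hB⟩ := exists_freshVar B p.2.2
  refine ⟨⟨(insert (W y) p.1.1, p.1.2), fun h => p.2.1 ?_, freshVars_insert_left _ p.2.2⟩,
    ⟨Set.subset_insert _ _, subset_rfl⟩, y, Set.mem_insert _ _⟩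
  obtain ⟨F, G, hF, hG, h⟩ := h.exists_of_insert_left
  exact ⟨insert A F, G, by simp [Set.insert_subset_iff, hA, hF], hG, (hW y F G
    ⟨fun C hC => hy.1 C (hF hC), fun C hC => hy.2 C (hG hC), .inl hB⟩).provable₁ h⟩

theorem exists_right_witness (p : ConsistentPair S) {A B : Formula S} {x : S.Var}
    (hA : A ∈ p.1.2) (W : S.Var → Formula S)
    (hW : ∀ y Γ Δ, Eigen y x B Γ Δ → Rule [Γ ⇒ insert (W y) Δ] (Γ ⇒ insert A Δ)) :
    ∃ q ≥ p, ∃ y, W y ∈ q.1.2 := by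
  obtain ⟨y, hy, hB⟩ := exists_freshVar B p.2.2
  refine ⟨⟨(p.1.1, insert (W y) p.1.2), fun h => p.2.1 ?_, freshVars_insert_right _ p.2.2⟩,
    ⟨subset_rfl, Set.subset_insert _ _⟩, y, Set.mem_insert _ _⟩
  obtain ⟨F, G, hF, hG, h⟩ := h.exists_of_insert_right
  exact ⟨F, insert A G, hF, by simp [Set.insert_subset_iff, hA, hG], (hW y F G
    ⟨fun C hC => hy.1 C (hF hC), fun C hC => hy.2 C (hG hC), .inl hB⟩).provable₁ h⟩

theorem exists_leftWitnessed (p : ConsistentPair S) {A : Formula S} (hA : A ∈ p.1.1) :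
    ∃ q ≥ p, LeftWitnessed A q.1.1 := by
  by_cases h₁ : ∃ x B, A = ex x B
  · obtain ⟨x, B, rfl⟩ := h₁
    obtain ⟨q, hq, y, hy⟩ := p.exists_left_witness hA (fun y => inst B x (.var y))
      fun y Γ Δ => Rule.ex_left x y B Γ Δ
    exact ⟨q, hq, by rintro _ _ ⟨⟩; exact ⟨y, hy⟩, by rintro _ _ ⟨⟩⟩
  by_cases h₂ : ∃ x B, A = neg (all x B)
  · obtain ⟨x, B, rfl⟩ := h₂
    obtain ⟨q, hq, y, hy⟩ := p.exists_left_witness hA (fun y => neg (inst B x (.var y)))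
      fun y Γ Δ => Rule.neg_all_left x y B Γ Δ
    exact ⟨q, hq, by rintro _ _ ⟨⟩, by rintro _ _ ⟨⟩; exact ⟨y, hy⟩⟩
  · exact ⟨p, le_rfl, fun x B h => (h₁ ⟨x, B, h⟩).elim, fun x B h => (h₂ ⟨x, B, h⟩).elim⟩

theorem exists_rightWitnessed (p : ConsistentPair S) {A : Formula S} (hA : A ∈ p.1.2) :
    ∃ q ≥ p, RightWitnessed A q.1.2 := by
  by_cases h₁ : ∃ x B, A = all x B
  · obtain ⟨x, B, rfl⟩ := h₁
    obtain ⟨q, hq, y, hy⟩ := p.exists_right_witness hA (fun y => inst B x (.var y))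
      fun y Γ Δ => Rule.all_right x y B Γ Δ
    exact ⟨q, hq, by rintro _ _ ⟨⟩; exact ⟨y, hy⟩, by rintro _ _ ⟨⟩⟩
  by_cases h₂ : ∃ x B, A = neg (ex x B)
  · obtain ⟨x, B, rfl⟩ := h₂
    obtain ⟨q, hq, y, hy⟩ := p.exists_right_witness hA (fun y => neg (inst B x (.var y)))
      fun y Γ Δ => Rule.neg_ex_right x y B Γ Δ
    exact ⟨q, hq, by rintro _ _ ⟨⟩, by rintro _ _ ⟨⟩; exact ⟨y, hy⟩⟩
  · exact ⟨p, le_rfl, fun x B h => (h₁ ⟨x, B, h⟩).elim, fun x B h => (h₂ ⟨x, B, h⟩).elim⟩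

/-- The pairs that decide `A` and have the witnesses needed for it. -/
def deciding (A : Formula S) : Order.Cofinal (ConsistentPair S) where
  carrier := {p | (A ∈ p.1.1 ∧ LeftWitnessed A p.1.1) ∨ (A ∈ p.1.2 ∧ RightWitnessed A p.1.2)}
  isCofinal p := by
    obtain ⟨q, hq, h | h⟩ := p.exists_decided A
    · obtain ⟨r, hr, h'⟩ := q.exists_leftWitnessed h
      exact ⟨r, .inl ⟨hr.1 h, h'⟩, hq.trans hr⟩
    · obtain ⟨r, hr, h'⟩ := q.exists_rightWitnessed h
      exact ⟨r, .inr ⟨hr.2 h, h'⟩, hq.trans hr⟩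

end ConsistentPair

/-- Sets of formulas that are closed under provable sequents and witness their existential
formulas. -/
structure Saturated (T : Set (Formula S)) : Prop where
  of_provable : ∀ {F G : Finset (Formula S)}, Provable (F ⇒ G) → (∀ A ∈ F, A ∈ T) → ∃ A ∈ G, A ∈ T
  ex_witness : ∀ {x B}, ex x B ∈ T → ∃ y, inst B x (.var y) ∈ T
  all_of_forall : ∀ {x B}, (∀ y, inst B x (.var y) ∈ T) → all x B ∈ T
  neg_all_witness : ∀ {x B}, neg (all x B) ∈ T → ∃ y, neg (inst B x (.var y)) ∈ T
  neg_ex_of_forall : ∀ {x B}, (∀ y, neg (inst B x (.var y)) ∈ T) → neg (ex x B) ∈ T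

theorem exists_saturated {Γ Δ : Set (Formula S)} (h : ¬ Derivable Γ Δ)
    (hf : (freshVars Γ Δ).Infinite) :
    ∃ T : Set (Formula S), Γ ⊆ T ∧ (∀ A ∈ Δ, A ∉ T) ∧ Saturated T := by
  have := Encodable.ofCountable (Formula S)
  let p₀ : ConsistentPair S := ⟨(Γ, Δ), h, hf⟩
  -- Rasiowa–Sikorski: countably many cofinal sets, one for each formula, are met by an ideal
  -- containing `p₀`.
  let I := Order.idealOfCofinals p₀ ConsistentPair.deciding
  have hp₀ : p₀ ∈ I := Order.mem_idealOfCofinals _ _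
  have hI : ∀ A : Formula S, ∃ p ∈ I, (A ∈ p.1.1 ∧ LeftWitnessed A p.1.1) ∨
      (A ∈ p.1.2 ∧ RightWitnessed A p.1.2) := fun A =>
    let ⟨p, hA, hp⟩ := Order.cofinal_meets_idealOfCofinals p₀ ConsistentPair.deciding A
    ⟨p, hp, hA⟩
  have disj : ∀ {p q : ConsistentPair S} {A}, p ∈ I → q ∈ I → A ∈ p.1.1 → A ∈ q.1.2 → False := by
    intro p q A hp hq h₁ h₂
    obtain ⟨r, -, hpr, hqr⟩ := I.directed p hp q hq
    exact r.disjoint (hpr.1 h₁) (hqr.2 h₂)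
  let T : Set (Formula S) := {A | ∃ p ∈ I, A ∈ p.1.1}
  have left : ∀ {A}, A ∈ T → ∃ p ∈ I, LeftWitnessed A p.1.1 := by
    rintro A ⟨p, hp, hA⟩
    obtain ⟨q, hq, h | h⟩ := hI A
    · exact ⟨q, hq, h.2⟩
    · exact (disj hp hq hA h.1).elim
  have right : ∀ {A}, A ∉ T → ∃ p ∈ I, A ∈ p.1.2 ∧ RightWitnessed A p.1.2 := by
    intro A hA
    obtain ⟨q, hq, h | h⟩ := hI A
    · exact (hA ⟨q, hq, h.1⟩).elim
    · exact ⟨q, hq, h⟩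
  refine ⟨T, fun A hA => ⟨p₀, hp₀, hA⟩, fun A hA ⟨p, hp, hpA⟩ => disj hp hp₀ hpA hA, ?_, ?_, ?_,
    ?_, ?_⟩
  · intro F G hFG hF
    -- By directedness, one pair in the ideal has all of `F` on its left and all of `G` on its
    -- right, contradicting its underivability.
    by_contra! hG
    have h₁ : ∃ p ∈ I, (F : Set (Formula S)) ⊆ p.1.1 := by
      clear hFG
      induction F using Finset.induction_on with
      | empty => exact ⟨p₀, hp₀, by simp⟩
      | insert A F _ ih =>
        obtain ⟨p, hp, hpF⟩ := ih fun B hB => hF B (by simp [hB])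
        obtain ⟨q, hq, hqA⟩ := hF A (by simp)
        obtain ⟨r, hr, hpr, hqr⟩ := I.directed p hp q hq
        exact ⟨r, hr, by simp [Set.insert_subset_iff, hqr.1 hqA, hpF.trans hpr.1]⟩
    have h₂ : ∃ p ∈ I, (G : Set (Formula S)) ⊆ p.1.2 := by
      clear hFG
      induction G using Finset.induction_on with
      | empty => exact ⟨p₀, hp₀, by simp⟩
      | insert A G _ ih =>
        obtain ⟨p, hp, hpG⟩ := ih fun B hB => hG B (by simp [hB])
        obtain ⟨q, hq, hqA, -⟩ := right (hG A (by simp))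
        obtain ⟨r, hr, hpr, hqr⟩ := I.directed p hp q hq
        exact ⟨r, hr, by simp [Set.insert_subset_iff, hqr.2 hqA, hpG.trans hpr.2]⟩
    obtain ⟨p, hp, hpF⟩ := h₁
    obtain ⟨q, hq, hqG⟩ := h₂
    obtain ⟨r, hr, hpr, hqr⟩ := I.directed p hp q hq
    exact r.2.1 ⟨F, G, hpF.trans hpr.1, hqG.trans hqr.2, hFG⟩
  · intro x B hB
    obtain ⟨p, hp, h⟩ := left hB
    obtain ⟨y, hy⟩ := h.1 x B rfl
    exact ⟨y, p, hp, hy⟩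
  · intro x B hB
    by_contra hA
    obtain ⟨p, hp, -, h⟩ := right hA
    obtain ⟨y, hy⟩ := h.1 x B rfl
    obtain ⟨q, hq, hqy⟩ := hB y
    exact disj hq hp hqy hy
  · intro x B hB
    obtain ⟨p, hp, h⟩ := left hB
    obtain ⟨y, hy⟩ := h.2 x B rfl
    exact ⟨y, p, hp, hy⟩
  · intro x B hB
    by_contra hA
    obtain ⟨p, hp, -, h⟩ := right hA
    obtain ⟨y, hy⟩ := h.2 x B rfl
    obtain ⟨q, hq, hqy⟩ := hB y
    exact disj hq hp hqy hy

/-! ### The term model of a saturated set -/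

theorem exists_fresh_for_tuple {k : ℕ} (ts : Fin k → Term S) (V : Finset S.Var) :
    ∃ x, (∀ i, x ∉ (ts i).fv) ∧ x ∉ V := by
  obtain ⟨x, hx⟩ := Infinite.exists_notMem_finset ((Finset.univ.biUnion fun i => (ts i).fv) ∪ V)
  simp only [Finset.mem_union, Finset.mem_biUnion, not_or, not_exists, Finset.mem_univ,
    true_and] at hx
  exact ⟨x, hx⟩

theorem Term.subst_update_of_notMem {x : S.Var} {s : Term S} (t : Term S) (h : x ∉ s.fv) :
    s.subst (Function.update Term.var x t) = s :=
  s.subst_of_fv _ fun _ hv => Function.update_of_ne (by rintro rfl; exact h hv) _ _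

/-- A fresh `x` in slot `i` marks the single place at which replacement acts. -/
theorem subst_update_tuple {k : ℕ} (ts : Fin k → Term S) (i : Fin k) {x : S.Var} (t : Term S)
    (h : ∀ j, x ∉ (ts j).fv) :
    (fun j => (Function.update ts i (.var x) j).subst (Function.update Term.var x t)) =
      Function.update ts i t := by
  funext j
  by_cases hj : j = i
  · subst hj; simp [Term.subst]
  · simp only [Function.update_of_ne hj]; exact Term.subst_update_of_notMem t (h j)

/-- Pass from `ts` to `us` one coordinate at a time; `J` is the set of coordinates already changed.
-/
theorem forall_update_induction {α : Type*} {k : ℕ} {R : α → α → Prop} {Q : (Fin k → α) → Prop}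
    (step : ∀ v i s t, R s t → Q (Function.update v i t) → Q (Function.update v i s))
    {us ts : Fin k → α} (h : ∀ i, R (us i) (ts i)) (hQ : Q ts) : Q us := by
  have key : ∀ J : Finset (Fin k), Q fun i => if i ∈ J then us i else ts i := by
    intro J
    induction J using Finset.induction_on with
    | empty => simpa using hQ
    | insert a J ha ih =>
      have h₁ : (fun i => if i ∈ J then us i else ts i) =
          Function.update (fun i => if i ∈ J then us i else ts i) a (ts a) := by
        rw [eq_comm, Function.update_eq_self_iff]; simp [ha]
      have h₂ : (fun i => if i ∈ insert a J then us i else ts i) =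
          Function.update (fun i => if i ∈ J then us i else ts i) a (us a) := by
        funext i
        by_cases hi : i = a
        · subst hi; simp
        · simp [hi]
      rw [h₂]
      rw [h₁] at ih
      exact step _ _ _ _ (h a) ih
  simpa using key Finset.univ

namespace Saturated

variable {T : Set (Formula S)} (hT : Saturated T)
include hT

theorem mem_of_provable {F : Finset (Formula S)} {A : Formula S} (h : Provable (F ⇒ {A}))
    (hF : ∀ B ∈ F, B ∈ T) : A ∈ T := by
  simpa using hT.of_provable h hF

/-! ### Equality in a saturated set is a congruence. -/

theorem equal_refl (t : Term S) : equal t t ∈ T :=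
  hT.mem_of_provable (F := ∅)
    ((Rule.eq_refl t _ _).provable₁ (provable_of_mem (A := equal t t) (by simp) (by simp)))
    (by simp)

theorem repl {A : Formula S} (hA : A.IsLiteral) (x : S.Var) {t₁ t₂ : Term S}
    (h : equal t₁ t₂ ∈ T) (h₂ : inst A x t₂ ∈ T) : inst A x t₁ ∈ T :=
  hT.mem_of_provable (F := {equal t₁ t₂, inst A x t₂})
    ((Rule.eq_repl x A t₁ t₂ ∅ _ hA).provable₁
      (provable_of_mem (A := inst A x t₁) (by simp) (by simp)))
    (by simp [h, h₂])

theorem pred_update {k : ℕ} {P : S.Pred k} {ts : Fin k → Term S} {i : Fin k} {t₁ t₂ : Term S}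
    (h : equal t₁ t₂ ∈ T) (h₂ : pred P (Function.update ts i t₂) ∈ T) :
    pred P (Function.update ts i t₁) ∈ T := by
  obtain ⟨x, hx, -⟩ := exists_fresh_for_tuple ts ∅
  have := hT.repl (A := pred P (Function.update ts i (.var x))) (.inl (.pred _ _)) x h
  simp only [inst, subst, subst_update_tuple ts i _ hx] at this
  exact this h₂

/-- Needed separately from the positive case because falsity of an atom is not determined by its
truth; it is the reason for replacement in negated atoms. -/
theorem neg_pred_update {k : ℕ} {P : S.Pred k} {ts : Fin k → Term S} {i : Fin k}
    {t₁ t₂ : Term S} (h : equal t₁ t₂ ∈ T) (h₂ : neg (pred P (Function.update ts i t₂)) ∈ T) :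
    neg (pred P (Function.update ts i t₁)) ∈ T := by
  obtain ⟨x, hx, -⟩ := exists_fresh_for_tuple ts ∅
  have := hT.repl (A := neg (pred P (Function.update ts i (.var x))))
    (.inr ⟨_, .pred _ _, rfl⟩) x h
  simp only [inst, subst, subst_update_tuple ts i _ hx] at this
  exact this h₂

theorem func_update {k : ℕ} {g : S.Func k} {ts : Fin k → Term S} {i : Fin k} {t₁ t₂ r : Term S}
    (h : equal t₁ t₂ ∈ T) (h₂ : equal (.func g (Function.update ts i t₂)) r ∈ T) :
    equal (.func g (Function.update ts i t₁)) r ∈ T := by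
  obtain ⟨x, hx, hr⟩ := exists_fresh_for_tuple ts r.fv
  have inst_eq : ∀ t, inst (equal (.func g (Function.update ts i (.var x))) r) x t =
      equal (.func g (Function.update ts i t)) r := by
    intro t
    simp only [inst, equal, subst]
    congr 1; funext j
    fin_cases j
    · simp [Term.subst, subst_update_tuple ts i t hx]
    · exact Term.subst_update_of_notMem t hr
  have := hT.repl (A := equal (.func g (Function.update ts i (.var x))) r) (.inl (.pred _ _)) x h
  rw [inst_eq, inst_eq] at this
  exact this h₂

theorem equal_symm {s t : Term S} (h : equal s t ∈ T) : equal t s ∈ T := by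
  have upd : ∀ r, Function.update ![t, t] 1 r = ![t, r] := fun r => by
    funext i; fin_cases i <;> simp
  -- Replace the second `t` in `t = t` by `s`.
  have := hT.pred_update (P := S.eq) (ts := ![t, t]) (i := 1) h
  rw [upd, upd] at this
  exact this (hT.equal_refl t)

theorem equal_trans {s t r : Term S} (h₁ : equal s t ∈ T) (h₂ : equal t r ∈ T) :
    equal s r ∈ T := by
  have upd : ∀ q, Function.update ![t, r] 0 q = ![q, r] := fun q => by
    funext i; fin_cases i <;> simp
  have := hT.pred_update (P := S.eq) (ts := ![t, r]) (i := 0) h₁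
  rw [upd, upd] at this
  exact this h₂

theorem pred_congr {k : ℕ} {P : S.Pred k} {us ts : Fin k → Term S}
    (h : ∀ i, equal (us i) (ts i) ∈ T) : pred P us ∈ T ↔ pred P ts ∈ T :=
  have aux {us ts : Fin k → Term S} (h : ∀ i, equal (us i) (ts i) ∈ T) :
      pred P ts ∈ T → pred P us ∈ T :=
    forall_update_induction (R := fun s t => equal s t ∈ T) (Q := fun v => pred P v ∈ T)
      (fun _ _ _ _ => hT.pred_update) h
  ⟨aux fun i => hT.equal_symm (h i), aux h⟩

theorem neg_pred_congr {k : ℕ} {P : S.Pred k} {us ts : Fin k → Term S}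
    (h : ∀ i, equal (us i) (ts i) ∈ T) : neg (pred P us) ∈ T ↔ neg (pred P ts) ∈ T :=
  have aux {us ts : Fin k → Term S} (h : ∀ i, equal (us i) (ts i) ∈ T) :
      neg (pred P ts) ∈ T → neg (pred P us) ∈ T :=
    forall_update_induction (R := fun s t => equal s t ∈ T) (Q := fun v => neg (pred P v) ∈ T)
      (fun _ _ _ _ => hT.neg_pred_update) h
  ⟨aux fun i => hT.equal_symm (h i), aux h⟩

theorem func_congr {k : ℕ} (g : S.Func k) {us ts : Fin k → Term S}
    (h : ∀ i, equal (us i) (ts i) ∈ T) : equal (.func g us) (.func g ts) ∈ T :=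
  forall_update_induction (R := fun s t => equal s t ∈ T)
    (Q := fun v => equal (.func g v) (.func g ts) ∈ T)
    (fun _ _ _ _ => hT.func_update) h (hT.equal_refl _)

/-- The quotient of the terms is countable, so `Shrink` moves it into the universe of the domains.
Chosen representatives `rep` allow the structure to be defined without lifting to the quotient. -/
theorem exists_classes : ∃ (D : Type w) (cls : Term S → D) (rep : D → Term S),
    (∀ d, cls (rep d) = d) ∧ ∀ s t, cls s = cls t ↔ equal s t ∈ T := by
  let r : Setoid (Term S) :=
    ⟨fun s t => equal s t ∈ T, hT.equal_refl, hT.equal_symm, hT.equal_trans⟩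
  refine ⟨Shrink.{w} (Quotient r), fun t => equivShrink _ (Quotient.mk r t),
    fun d => Quotient.out ((equivShrink _).symm d), fun d => by simp, fun s t => ?_⟩
  rw [EmbeddingLike.apply_eq_iff_eq, Quotient.eq]
  rfl

theorem exists_termModel : ∃ (M : Model.{u, w} S) (cls : Term S → M.Dom),
    Function.Surjective cls ∧
    (∀ t, t.eval M (fun x => cls (.var x)) = cls t) ∧
    (∀ {k : ℕ} (P : S.Pred k) (ts : Fin k → Term S),
      (Sat M (fun x => cls (.var x)) (pred P ts) ↔ pred P ts ∈ T) ∧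
      (Sat M (fun x => cls (.var x)) (neg (pred P ts)) ↔ neg (pred P ts) ∈ T)) := by
  obtain ⟨D, cls, rep, hrep, hcls⟩ := hT.exists_classes
  have rep_cls : ∀ t, equal (rep (cls t)) t ∈ T := fun t => (hcls _ _).1 (hrep _)
  let M : Model.{u, w} S :=
    { Dom := D
      nonempty := ⟨cls (.var (Classical.arbitrary _))⟩
      func := fun g ds => cls (.func g fun i => rep (ds i))
      -- Both, one or neither of an atom and its negation may lie in `T`: these are the four values.
      -- The equality condition concerns only the truth part.
      pred := fun P ds => TV.ofProps (pred P (fun i => rep (ds i)) ∈ T)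
        (neg (pred P fun i => rep (ds i)) ∈ T)
      eq_designated := fun d e => by
        have : (fun i => rep (![d, e] i)) = ![rep d, rep e] := by
          funext i; fin_cases i <;> rfl
        rw [TV.ofProps_designated, this, ← hrep d, ← hrep e, hcls, hrep, hrep]
        rfl }
  have heval : ∀ t : Term S, t.eval M (fun x => cls (.var x)) = cls t := by
    intro t
    induction t with
    | var x => rfl
    | func g ts ih =>
      simp only [Term.eval, ih]
      exact (hcls _ _).2 (hT.func_congr g fun i => rep_cls (ts i))
  refine ⟨M, cls, fun d => ⟨rep d, hrep d⟩, heval, fun P ts => ⟨?_, ?_⟩⟩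
  · unfold Sat
    simp only [Formula.eval, heval]
    exact (TV.ofProps_designated _ _).trans (hT.pred_congr fun i => rep_cls (ts i))
  · unfold Sat
    simp only [Formula.eval, heval]
    exact (TV.neg_ofProps_designated _ _).trans (hT.neg_pred_congr fun i => rep_cls (ts i))

/-! ### Membership of compound formulas in saturated sets -/

theorem fls_notMem : fls ∉ T := fun h => by
  simpa using hT.of_provable (F := {fls}) (G := ∅) (Rule.fls_left ∅ ∅).provable₀ (by simpa)

theorem neg_fls_mem : neg fls ∈ T :=
  hT.mem_of_provable (F := ∅) (Rule.neg_fls_right ∅ ∅).provable₀ (by simp)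

theorem neg_neg_mem {A : Formula S} : neg (neg A) ∈ T ↔ A ∈ T :=
  ⟨fun h => hT.mem_of_provable (F := {neg (neg A)})
      ((Rule.neg_neg_left A ∅ _).provable₁
        (provable_of_mem (A := A) (by simp) (by simp))) (by simpa),
    fun h => hT.mem_of_provable (F := {A})
      ((Rule.neg_neg_right A _ ∅).provable₁
        (provable_of_mem (A := A) (by simp) (by simp))) (by simpa)⟩

theorem conj_mem {A B : Formula S} : conj A B ∈ T ↔ A ∈ T ∧ B ∈ T :=
  ⟨fun h =>
    ⟨hT.mem_of_provable (F := {conj A B}) ((Rule.conj_left A B ∅ _).provable₁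
        (provable_of_mem (A := A) (by simp) (by simp))) (by simpa),
      hT.mem_of_provable (F := {conj A B}) ((Rule.conj_left A B ∅ _).provable₁
        (provable_of_mem (A := B) (by simp) (by simp))) (by simpa)⟩,
    fun h => hT.mem_of_provable (F := {A, B}) ((Rule.conj_right A B _ ∅).provable₂
      (provable_of_mem (A := A) (by simp) (by simp))
      (provable_of_mem (A := B) (by simp) (by simp))) (by simpa)⟩

theorem neg_disj_mem {A B : Formula S} : neg (disj A B) ∈ T ↔ neg A ∈ T ∧ neg B ∈ T :=
  ⟨fun h =>
    ⟨hT.mem_of_provable (F := {neg (disj A B)}) ((Rule.neg_disj_left A B ∅ _).provable₁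
        (provable_of_mem (A := neg A) (by simp) (by simp))) (by simpa),
      hT.mem_of_provable (F := {neg (disj A B)}) ((Rule.neg_disj_left A B ∅ _).provable₁
        (provable_of_mem (A := neg B) (by simp) (by simp))) (by simpa)⟩,
    fun h => hT.mem_of_provable (F := {neg A, neg B}) ((Rule.neg_disj_right A B _ ∅).provable₂
      (provable_of_mem (A := neg A) (by simp) (by simp))
      (provable_of_mem (A := neg B) (by simp) (by simp))) (by simpa)⟩

theorem neg_imp_mem {A B : Formula S} : neg (imp A B) ∈ T ↔ A ∈ T ∧ neg B ∈ T :=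
  ⟨fun h =>
    ⟨hT.mem_of_provable (F := {neg (imp A B)}) ((Rule.neg_imp_left A B ∅ _).provable₁
        (provable_of_mem (A := A) (by simp) (by simp))) (by simpa),
      hT.mem_of_provable (F := {neg (imp A B)}) ((Rule.neg_imp_left A B ∅ _).provable₁
        (provable_of_mem (A := neg B) (by simp) (by simp))) (by simpa)⟩,
    fun h => hT.mem_of_provable (F := {A, neg B}) ((Rule.neg_imp_right A B _ ∅).provable₂
      (provable_of_mem (A := A) (by simp) (by simp))
      (provable_of_mem (A := neg B) (by simp) (by simp))) (by simpa)⟩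

theorem disj_mem {A B : Formula S} : disj A B ∈ T ↔ A ∈ T ∨ B ∈ T := by
  refine ⟨fun h => ?_, ?_⟩
  · simpa using hT.of_provable (F := {disj A B}) (G := {A, B})
      ((Rule.disj_left A B ∅ _).provable₂ (provable_of_mem (A := A) (by simp) (by simp))
        (provable_of_mem (A := B) (by simp) (by simp))) (by simpa)
  · rintro (h | h)
    · exact hT.mem_of_provable (F := {A}) ((Rule.disj_right A B _ ∅).provable₁
        (provable_of_mem (A := A) (by simp) (by simp))) (by simpa)
    · exact hT.mem_of_provable (F := {B}) ((Rule.disj_right A B _ ∅).provable₁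
        (provable_of_mem (A := B) (by simp) (by simp))) (by simpa)

theorem neg_conj_mem {A B : Formula S} : neg (conj A B) ∈ T ↔ neg A ∈ T ∨ neg B ∈ T := by
  refine ⟨fun h => ?_, ?_⟩
  · simpa using hT.of_provable (F := {neg (conj A B)}) (G := {neg A, neg B})
      ((Rule.neg_conj_left A B ∅ _).provable₂
        (provable_of_mem (A := neg A) (by simp) (by simp))
        (provable_of_mem (A := neg B) (by simp) (by simp))) (by simpa)
  · rintro (h | h)
    · exact hT.mem_of_provable (F := {neg A}) ((Rule.neg_conj_right A B _ ∅).provable₁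
        (provable_of_mem (A := neg A) (by simp) (by simp))) (by simpa)
    · exact hT.mem_of_provable (F := {neg B}) ((Rule.neg_conj_right A B _ ∅).provable₁
        (provable_of_mem (A := neg B) (by simp) (by simp))) (by simpa)

/-- Designation of an implication is classical: if `A ∉ T`, the provable sequent with empty
antecedent and succedent `imp A B, A` forces the implication into `T`. -/
theorem imp_mem {A B : Formula S} : imp A B ∈ T ↔ (A ∈ T → B ∈ T) := by
  refine ⟨fun h hA => ?_, fun h => ?_⟩
  · exact hT.mem_of_provable (F := {imp A B, A}) ((Rule.imp_left A B {A} _).provable₂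
      (provable_of_mem (A := A) (by simp) (by simp))
      (provable_of_mem (A := B) (by simp) (by simp))) (by simp [h, hA])
  · by_cases hA : A ∈ T
    · exact hT.mem_of_provable (F := {B}) ((Rule.imp_right A B _ ∅).provable₁
        (provable_of_mem (A := B) (by simp) (by simp))) (by simpa using h hA)
    · have := hT.of_provable (F := ∅) (G := {imp A B, A}) ((Rule.imp_right A B _ {A}).provable₁
        (provable_of_mem (A := A) (by simp) (by simp))) (by simp)
      simpa [hA] using this

/-- The rule gives all term instances; conversely variable instances suffice, since a universal
formula outside `T` has a variable instance outside `T`. -/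
theorem all_mem {x : S.Var} {A : Formula S} : all x A ∈ T ↔ ∀ t, inst A x t ∈ T :=
  ⟨fun h t => hT.mem_of_provable (F := {all x A}) ((Rule.all_left x A t ∅ _).provable₁
    (provable_of_mem (A := inst A x t) (by simp) (by simp))) (by simpa),
    fun h => hT.all_of_forall fun y => h _⟩

theorem neg_ex_mem {x : S.Var} {A : Formula S} :
    neg (ex x A) ∈ T ↔ ∀ t, neg (inst A x t) ∈ T :=
  ⟨fun h t => hT.mem_of_provable (F := {neg (ex x A)}) ((Rule.neg_ex_left x A t ∅ _).provable₁
    (provable_of_mem (A := neg (inst A x t)) (by simp) (by simp))) (by simpa),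
    fun h => hT.neg_ex_of_forall fun y => h _⟩

theorem ex_mem {x : S.Var} {A : Formula S} : ex x A ∈ T ↔ ∃ t, inst A x t ∈ T :=
  ⟨fun h => let ⟨_, hy⟩ := hT.ex_witness h; ⟨_, hy⟩, fun ⟨t, ht⟩ =>
    hT.mem_of_provable (F := {inst A x t}) ((Rule.ex_right x A t _ ∅).provable₁
      (provable_of_mem (A := inst A x t) (by simp) (by simp))) (by simpa)⟩

theorem neg_all_mem {x : S.Var} {A : Formula S} :
    neg (all x A) ∈ T ↔ ∃ t, neg (inst A x t) ∈ T :=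
  ⟨fun h => let ⟨_, hy⟩ := hT.neg_all_witness h; ⟨_, hy⟩, fun ⟨t, ht⟩ =>
    hT.mem_of_provable (F := {neg (inst A x t)}) ((Rule.neg_all_right x A t _ ∅).provable₁
      (provable_of_mem (A := neg (inst A x t)) (by simp) (by simp))) (by simpa)⟩

/-- Truth lemma: the clauses for designation and for membership in `T` coincide, so they agree by
induction on size, for `A` and `neg A` together. -/
theorem exists_model : ∃ (M : Model.{u, w} S) (α : S.Var → M.Dom),
    ∀ A, Sat M α A ↔ A ∈ T := by
  obtain ⟨M, cls, hsurj, heval, hpred⟩ := hT.exists_termModel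
  refine ⟨M, fun x => cls (.var x), ?_⟩
  set α : S.Var → M.Dom := fun x => cls (.var x)
  suffices H : ∀ (k : ℕ) (A : Formula S), A.size = k →
      (Sat M α A ↔ A ∈ T) ∧ (Sat M α (neg A) ↔ neg A ∈ T) from fun A => (H _ A rfl).1
  intro k
  induction k using Nat.strong_induction_on with
  | _ k ih =>
  intro A hA
  replace ih : ∀ B : Formula S, B.size < A.size →
      (Sat M α B ↔ B ∈ T) ∧ (Sat M α (neg B) ↔ neg B ∈ T) := fun B hB => ih _ (hA ▸ hB) B rfl
  cases A with
  | pred P ts => exact hpred P ts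
  | fls => exact ⟨iff_of_false (sat_fls M α) hT.fls_notMem,
      iff_of_true (sat_neg_fls M α) hT.neg_fls_mem⟩
  | neg A =>
    have h := ih A (by simp [size])
    rw [sat_neg_neg, hT.neg_neg_mem]
    exact ⟨h.2, h.1⟩
  | conj A B =>
    have hA := ih A (by simp [size])
    have hB := ih B (by simp [size])
    rw [sat_conj, sat_neg_conj, hT.conj_mem, hT.neg_conj_mem, hA.1, hA.2, hB.1, hB.2]
    exact ⟨.rfl, .rfl⟩
  | disj A B =>
    have hA := ih A (by simp [size])
    have hB := ih B (by simp [size])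
    rw [sat_disj, sat_neg_disj, hT.disj_mem, hT.neg_disj_mem, hA.1, hA.2, hB.1, hB.2]
    exact ⟨.rfl, .rfl⟩
  | imp A B =>
    have hA := ih A (by simp [size])
    have hB := ih B (by simp [size])
    rw [sat_imp, sat_neg_imp, hT.imp_mem, hT.neg_imp_mem, hA.1, hB.1, hB.2]
    exact ⟨.rfl, .rfl⟩
  | all x A =>
    have h := fun t => ih (inst A x t) (by simp [size, size_inst])
    simp only [sat_inst, sat_neg_inst, heval] at h
    -- Every element of the domain is the class of a term, so quantifying over elements is
    -- quantifying over term instances.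
    rw [sat_all, sat_neg_all, hT.all_mem, hT.neg_all_mem, hsurj.forall, hsurj.exists]
    exact ⟨forall_congr' fun t => (h t).1, exists_congr fun t => (h t).2⟩
  | ex x A =>
    have h := fun t => ih (inst A x t) (by simp [size, size_inst])
    simp only [sat_inst, sat_neg_inst, heval] at h
    rw [sat_ex, sat_neg_ex, hT.ex_mem, hT.neg_ex_mem, hsurj.forall, hsurj.exists]
    exact ⟨exists_congr fun t => (h t).1, forall_congr' fun t => (h t).2⟩

end Saturated

/-! ### Soundness and completeness -/

theorem Derivable.consequence {Γ Δ : Set (Formula S)} (h : Derivable Γ Δ) :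
    Consequence.{u, w} Γ Δ := by
  obtain ⟨F, G, hF, hG, h⟩ := h
  intro M α hΓ
  obtain ⟨A, hA, hs⟩ := h.valid M α fun A hA => hΓ A (hF hA)
  exact ⟨A, hG hA, hs⟩

theorem Consequence.derivable_of_freshVars {Γ Δ : Set (Formula S)}
    (h : Consequence.{u, w} Γ Δ) (hf : (freshVars Γ Δ).Infinite) : Derivable Γ Δ := by
  by_contra hd
  obtain ⟨T, hΓ, hΔ, hT⟩ := exists_saturated hd hf
  obtain ⟨M, α, hM⟩ := Saturated.exists_model.{u, w} hT
  obtain ⟨A, hA, hs⟩ := h M α fun A hA => (hM A).2 (hΓ hA)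
  exact hΔ A hA ((hM A).1 hs)

theorem provable_of_consequence {F G : Finset (Formula S)}
    (h : Consequence.{u, w} (F : Set (Formula S)) G) : Provable (F ⇒ G) := by
  obtain ⟨F', G', hF, hG, h⟩ := h.derivable_of_freshVars (by
    refine (Finset.finite_toSet (F.biUnion fv ∪ G.biUnion fv)).infinite_compl.mono fun y hy => ?_
    simpa [freshVars, not_or] using hy)
  exact h.weaken (by exact_mod_cast hF) (by exact_mod_cast hG)

/-- Renaming of the free variables. -/
noncomputable def Formula.rename (ρ : S.Var → S.Var) (A : Formula S) : Formula S :=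
  A.subst fun v => .var (ρ v)

theorem sat_rename (M : Model.{u, w} S) (α : S.Var → M.Dom) (ρ : S.Var → S.Var)
    (A : Formula S) : Sat M α (A.rename ρ) ↔ Sat M (α ∘ ρ) A := by
  unfold Sat rename
  rw [eval_subst]
  rfl

theorem notMem_fv_rename {ρ : S.Var → S.Var} {A : Formula S} {y : S.Var}
    (hy : y ∉ Set.range ρ) : y ∉ (A.rename ρ).fv := fun h => by
  obtain ⟨z, -, hz⟩ := fv_subst _ A h
  exact hy ⟨z, by simpa [Term.fv, eq_comm] using hz⟩

/-- Identify `α` with two copies of itself: embed into the left copy, and the right copy is missed.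
-/
theorem exists_injective_infinite_compl_range (α : Type*) [Infinite α] :
    ∃ ρ : α → α, Function.Injective ρ ∧ (Set.range ρ)ᶜ.Infinite := by
  obtain ⟨e⟩ : Nonempty (α ⊕ α ≃ α) := Cardinal.eq.1 (by simp)
  refine ⟨e ∘ Sum.inl, e.injective.comp Sum.inl_injective, ?_⟩
  refine (Set.infinite_range_of_injective (e.injective.comp Sum.inr_injective)).mono ?_
  rintro _ ⟨a, rfl⟩ ⟨b, hb⟩
  simpa using e.injective hb

theorem Consequence.derivable {Γ Δ : Set (Formula S)} (h : Consequence.{u, w} Γ Δ) :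
    Derivable Γ Δ := by
  obtain ⟨ρ, hρ, hinf⟩ := exists_injective_infinite_compl_range S.Var
  have h₁ : Consequence.{u, w} (rename ρ '' Γ) (rename ρ '' Δ) := by
    intro M α hΓ
    obtain ⟨A, hA, hs⟩ := h M (α ∘ ρ) fun A hA =>
      (sat_rename M α ρ A).1 (hΓ _ (Set.mem_image_of_mem _ hA))
    exact ⟨_, Set.mem_image_of_mem _ hA, (sat_rename M α ρ A).2 hs⟩
  obtain ⟨F', G', hF, hG, hp⟩ := h₁.derivable_of_freshVars (hinf.mono fun y hy =>
    ⟨by rintro _ ⟨A, -, rfl⟩; exact notMem_fv_rename hy,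
      by rintro _ ⟨A, -, rfl⟩; exact notMem_fv_rename hy⟩)
  obtain ⟨F, hFΓ, rfl⟩ := Finset.subset_set_image_iff.1 hF
  obtain ⟨G, hGΔ, rfl⟩ := Finset.subset_set_image_iff.1 hG
  refine ⟨F, G, hFΓ, hGΔ, provable_of_consequence.{u, w} fun M α hα => ?_⟩
  -- Injectivity of `ρ` lets `α` be transported along it; the values off the range of `ρ` are
  -- immaterial.
  have inv : Function.extend ρ α α ∘ ρ = α := funext fun v => hρ.extend_apply _ _ v
  obtain ⟨B, hB, hs⟩ := hp.valid M (Function.extend ρ α α) (by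
    simp only [Finset.forall_mem_image, sat_rename, inv]
    exact hα)
  obtain ⟨A, hA, rfl⟩ := Finset.mem_image.1 hB
  rw [sat_rename, inv] at hs
  exact ⟨A, hA, hs⟩

end BDif

theorem theorem4 (S : BDif.Alphabet.{u}) (Γ Δ : Set (BDif.Formula S)) :
    BDif.Derivable Γ Δ ↔ BDif.Consequence.{u, w} Γ Δ :=
  ⟨BDif.Derivable.consequence, BDif.Consequence.derivable⟩
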